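/- Let $T$ be a finitary polynomial monad on $\mathbf{Set}/I$, generated by a polynomial $I\xleftarrow{s}E\xrightarrow{p}B\xrightarrow{t}I$ with finite fibres $E_b=p^{-1}(b)$, with units $1_i\in B$. An element $b\in B$ is viewed as a corolla with one incoming edge of colour $s(e)$ for each $e\in E_b$ and an outgoing edge of colour $t(b)$. For a cartesian morphism of polynomial monads $\Phi:S\to T$ over $\delta:J\to I$ with $\phi:B_S\to B$ on operations, the classifier $\mathbf{T}^{S}$ is the category whose objects are pairs $a=(b,c)$ with $b\in B$ and $c:E_b\to J$ satisfying $\delta c=s$; a morphism $a'\to a$ is a family $(d_e)_{e\in E_b}$ of operations of $S$ with $t_S(d_e)=c(e)$ such that $a'$ is obtained by substituting the $\phi(d_e)$ into $b$, the edges of $a'$ being coloured by the sources of the $d_e$; composition is substitution. We use the following monads, with evident morphisms to $T$: $T+1$ with $(T+1)(X,K)=(TX,K)$, $T+2$ with $(T+2)(X,K,L)=(TX,K,L)$, and $T_{f,g}$ with $T_{f,g}(X,K,L)=(T(X\sqcup K),K,K\sqcup L)$, whose algebras are a $T$-algebra $X$ with maps $g:K\to X$ and $f:K\to L$. Thus the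 objects of $\mathbf{T}^{T+1}$ are corollas with edges coloured $X$ or $K$, and $\mathbf{T}^{T+2}$ and $\mathbf{T}^{T_{f,g}}$ have the same objects, namely corollas with edges coloured $X$, $K$ or $L$. The monad $T$ is \emph{tame} if $\mathbf{T}^{T+1}$ is a coproduct of categories with terminal object. Let $T$ be tame and let $X:\mathbf{T}^{T_{f,g}}\to\mathcal{E}$ be a functor to a cocomplete category. Then each connected component of $\mathbf{T}^{T+2}$ has a terminal object. Choose one in each component, and let $\mathbf{t}$ be the full subcategory of $\mathbf{T}^{T_{f,g}}$ on the chosen objects. Let the degree of an object be its number of $K$- and $L$-edges. Let $\mathbf{t}^{(k)}$ (resp. $\mathbf{w}^{(k)}$) be the full subcategory of $\mathbf{t}$ on the objects of degree $\le k$ (resp. $=k$), let $\mathbf{q}^{(k)}$ (resp. $\mathbf{l}^{(k)}$) be the full subcategory of $\mathbf{w}^{(k)}$ on the objects with at least one (resp. with no) $K$-edge, and let $\overline{\mathbf{q}}^{(k)}$ be the full subcategory of $\mathbf{t}^{(k)}$ on the objects not in $\mathbf{l}^{(k)}$. Let $P_k$, $Q_k$, $L_k$ be the colimits of the restrictions of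 $X$ to $\mathbf{t}^{(k)}$, $\mathbf{q}^{(k)}$, $\mathbf{l}^{(k)}$. Then, for every such choice: 1. The canonical maps $P_k\to\operatorname{colim}X$ exhibit $\operatorname{colim}X$ as the sequential colimit $\operatorname{colim}_kP_k$, and the canonical map $L_0\to P_0$ is an isomorphism. 2. For each $k\ge1$ the canonical maps $L_k\to\operatorname{colim}_{\mathbf{w}^{(k)}}X$ and $P_{k-1}\to\operatorname{colim}_{\overline{\mathbf{q}}^{(k)}}X$ are isomorphisms; if $w_k:Q_k\to L_k$ and $\alpha_k:Q_k\to P_{k-1}$ denote the maps induced by $\mathbf{q}^{(k)}\subset\mathbf{w}^{(k)}$ and $\mathbf{q}^{(k)}\subset\overline{\mathbf{q}}^{(k)}$ through these isomorphisms, then, with the canonical maps $L_k\to P_k$ and $P_{k-1}\to P_k$, $$\begin{array}{ccc}Q_k&\xrightarrow{\ w_k\ }&L_k\\ {\scriptstyle\alpha_k}\downarrow&&\downarrow\\ P_{k-1}&\longrightarrow&P_k\end{array}$$ is a pushout square in $\mathcal{E}$. 3. For each $k\ge0$ the category $\mathbf{w}^{(k)}$ is isomorphic to a coproduct of $k$-cubes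 (posets of all subsets of a $k$-element set), in such a way that $\mathbf{q}^{(k)}$ corresponds to the coproduct of the punctured $k$-cubes (all proper subsets) and $\mathbf{l}^{(k)}$ to the set of their terminal vertices. -/

import Mathlib

open CategoryTheory CategoryTheory.Limits

universe u v w

/-- A finitary polynomial monad on `Set/I`: a polynomial `I ← E → B → I` with finite fibres
`E b` (`b : B`), with a unit and a multiplication which are cartesian morphisms of polynomials
and satisfy the monad laws. `join` expresses that the multiplication is cartesian:
the fibre over a composite operation `mul b β` is the disjoint union of the fibres over `β e`.
Equations between elements of different fibres are stated in the total set `Σ b, E b`. -/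
structure PolyMonad (I : Type u) where
  B : Type u
  E : B → Type u
  finite_E : ∀ b, Finite (E b)
  s : ∀ {b}, E b → I
  t : B → I
  one : I → B
  t_one : ∀ i, t (one i) = i
  uniqueE : ∀ i, Unique (E (one i))
  s_one : ∀ i (e : E (one i)), s e = i
  mul : ∀ (b : B) (β : E b → B), (∀ e, t (β e) = s e) → B
  t_mul : ∀ b β h, t (mul b β h) = t b
  join : ∀ b β h, (Σ e : E b, E (β e)) ≃ E (mul b β h)
  s_join : ∀ b β h (x : Σ e : E b, E (β e)), s (join b β h x) = s x.2
  mul_one : ∀ b, mul b (fun e => one (s e)) (fun _ => t_one _) = b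
  join_one : ∀ b (e : E b) (e' : E (one (s e))),
    (⟨_, join b (fun e => one (s e)) (fun _ => t_one _) ⟨e, e'⟩⟩ : Σ b, E b) = ⟨b, e⟩
  one_mul : ∀ i b (h : ∀ e : E (one i), t b = s e), mul (one i) (fun _ => b) h = b
  one_join : ∀ i b (h : ∀ e : E (one i), t b = s e) (e : E (one i)) (e' : E b),
    (⟨_, join (one i) (fun _ => b) h ⟨e, e'⟩⟩ : Σ b, E b) = ⟨b, e'⟩
  mul_assoc : ∀ b (β : E b → B) h (γ : ∀ e, E (β e) → B) (k : ∀ e e', t (γ e e') = s e'),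
    mul (mul b β h) (fun x => γ _ ((join b β h).symm x).2)
        (fun x => by rw [k, ← s_join b β h, Equiv.apply_symm_apply]) =
      mul b (fun e => mul (β e) (γ e) (k e)) (fun e => (t_mul _ _ _).trans (h e))
  join_assoc : ∀ b (β : E b → B) h (γ : ∀ e, E (β e) → B) (k : ∀ e e', t (γ e e') = s e')
      (x : E (mul b β h)) (e'' : E (γ _ ((join b β h).symm x).2)),
    (⟨_, join (mul b β h) (fun x => γ _ ((join b β h).symm x).2)
        (fun x => by rw [k, ← s_join b β h, Equiv.apply_symm_apply]) ⟨x, e''⟩⟩ :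
        Σ b, E b) =
      ⟨_, join b (fun e => mul (β e) (γ e) (k e)) (fun e => (t_mul _ _ _).trans (h e))
        ⟨_, join _ (γ _) (k _) ⟨((join b β h).symm x).2, e''⟩⟩⟩

namespace PolyMonad

variable {I : Type u} (T : PolyMonad I)

attribute [instance] PolyMonad.finite_E PolyMonad.uniqueE

theorem mul_congr {b : T.B} {β β' : T.E b → T.B} {h h'} (hβ : ∀ e, β e = β' e) :
    T.mul b β h = T.mul b β' h' := by
  obtain rfl : β = β' := funext hβ
  rfl

theorem join_congr {b : T.B} {β β' : T.E b → T.B} {h h'} (hβ : ∀ e, β e = β' e)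
    {e : T.E b} {x : T.E (β e)} {x' : T.E (β' e)}
    (hx : (⟨β e, x⟩ : Σ b, T.E b) = ⟨β' e, x'⟩) :
    (⟨_, T.join b β h ⟨e, x⟩⟩ : Σ b, T.E b) = ⟨_, T.join b β' h' ⟨e, x'⟩⟩ := by
  obtain rfl : β = β' := funext hβ
  obtain rfl : x = x' := by simpa using hx
  rfl

theorem mul_assoc' {b : T.B} {β : T.E b → T.B} {h} {γ : ∀ e, T.E (β e) → T.B}
    (k : ∀ e e', T.t (γ e e') = T.s e') {β' : T.E (T.mul b β h) → T.B} {h'}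
    (hβ' : ∀ e e', β' (T.join b β h ⟨e, e'⟩) = γ e e') :
    T.mul (T.mul b β h) β' h' =
      T.mul b (fun e => T.mul (β e) (γ e) (k e)) (fun e => (T.t_mul _ _ _).trans (h e)) := by
  rw [← T.mul_assoc b β h γ k]
  refine T.mul_congr fun x => ?_
  rw [← hβ', Equiv.apply_symm_apply]

theorem join_assoc' {b : T.B} {β : T.E b → T.B} {h} {γ : ∀ e, T.E (β e) → T.B}
    (k : ∀ e e', T.t (γ e e') = T.s e') {β' : T.E (T.mul b β h) → T.B} {h'}
    (hβ' : ∀ e e', β' (T.join b β h ⟨e, e'⟩) = γ e e') {e : T.E b} {e' : T.E (β e)}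
    {x : T.E (β' (T.join b β h ⟨e, e'⟩))} {x' : T.E (γ e e')}
    (hx : (⟨_, x⟩ : Σ b, T.E b) = ⟨_, x'⟩) :
    (⟨_, T.join (T.mul b β h) β' h' ⟨T.join b β h ⟨e, e'⟩, x⟩⟩ : Σ b, T.E b) =
      ⟨_, T.join b (fun e => T.mul (β e) (γ e) (k e)) (fun e => (T.t_mul _ _ _).trans (h e))
        ⟨e, T.join _ (γ e) (k e) ⟨e', x'⟩⟩⟩ := by
  have hβ : ∀ z, β' z = γ _ ((T.join b β h).symm z).2 := fun z => by
    rw [← hβ', Equiv.apply_symm_apply]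
  obtain rfl : β' = _ := funext hβ
  refine (T.join_assoc b β h γ k _ x).trans ?_
  clear hβ hβ'
  have key : ∀ (p : Σ e, T.E (β e)) (y : T.E (γ p.1 p.2)), p = ⟨e, e'⟩ →
      (⟨_, y⟩ : Σ b, T.E b) = ⟨_, x'⟩ →
      (⟨_, T.join b (fun e => T.mul (β e) (γ e) (k e)) (fun e => (T.t_mul _ _ _).trans (h e))
        ⟨p.1, T.join _ (γ p.1) (k p.1) ⟨p.2, y⟩⟩⟩ : Σ b, T.E b) =
      ⟨_, T.join b (fun e => T.mul (β e) (γ e) (k e)) (fun e => (T.t_mul _ _ _).trans (h e))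
        ⟨e, T.join _ (γ e) (k e) ⟨e', x'⟩⟩⟩ := by
    rintro p y rfl hy
    obtain rfl : y = x' := by simpa using hy
    rfl
  exact key _ x (Equiv.symm_apply_apply _ _) hx

end PolyMonad

/-- A cartesian morphism `(δ, ψ, φ)` from the polynomial monad `S` on `Set/J` to the polynomial
monad `T` on `Set/I`. The middle square is a pullback because `ψ` is bijective on fibres. -/
structure CartMor {I J : Type u} (S : PolyMonad J) (T : PolyMonad I) (δ : J → I) where
  φ : S.B → T.B
  ψ : ∀ b, S.E b ≃ T.E (φ b)
  s_ψ : ∀ b (e : S.E b), T.s (ψ b e) = δ (S.s e)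
  t_φ : ∀ b, T.t (φ b) = δ (S.t b)
  φ_one : ∀ j, φ (S.one j) = T.one (δ j)
  φ_mul : ∀ b β h, φ (S.mul b β h) = T.mul (φ b) (fun e => φ (β ((ψ b).symm e)))
    (fun e => by rw [t_φ, h, ← s_ψ, Equiv.apply_symm_apply])
  ψ_join : ∀ b β h (e : T.E (φ b)) (e' : S.E (β ((ψ b).symm e))),
    (⟨_, ψ _ (S.join b β h ⟨(ψ b).symm e, e'⟩)⟩ : Σ b, T.E b) =
      ⟨_, T.join (φ b) (fun e => φ (β ((ψ b).symm e)))
        (fun e => by rw [t_φ, h, ← s_ψ, Equiv.apply_symm_apply]) ⟨e, ψ _ e'⟩⟩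

namespace CartMor

variable {I J : Type u} {S : PolyMonad J} {T : PolyMonad I} {δ : J → I} (Φ : CartMor S T δ)

theorem φ_mul' {b : S.B} {β : S.E b → S.B} {h} {β' : T.E (Φ.φ b) → T.B} {h'}
    (hβ : ∀ e, β' (Φ.ψ b e) = Φ.φ (β e)) :
    Φ.φ (S.mul b β h) = T.mul (Φ.φ b) β' h' := by
  refine (Φ.φ_mul _ _ _).trans (T.mul_congr fun e => ?_)
  rw [← hβ, Equiv.apply_symm_apply]

theorem ψ_join' {b : S.B} {β : S.E b → S.B} {h} {β' : T.E (Φ.φ b) → T.B} {h'}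
    (hβ : ∀ e, β' (Φ.ψ b e) = Φ.φ (β e)) {e : S.E b} {x : S.E (β e)} {x' : T.E (β' (Φ.ψ b e))}
    (hx : (⟨_, x'⟩ : Σ b, T.E b) = ⟨_, Φ.ψ _ x⟩) :
    (⟨_, Φ.ψ _ (S.join b β h ⟨e, x⟩)⟩ : Σ b, T.E b) = ⟨_, T.join (Φ.φ b) β' h' ⟨Φ.ψ b e, x'⟩⟩ := by
  have hβ2 : ∀ e, Φ.φ (β ((Φ.ψ b).symm e)) = β' e := fun e => by
    rw [← hβ, Equiv.apply_symm_apply]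
  obtain ⟨y, rfl⟩ := (Φ.ψ b).symm.surjective e
  refine (Φ.ψ_join b β h y x).trans ?_
  have key : ∀ (z : T.E (Φ.φ b)) (x'' : T.E (β' z)), z = y →
      (⟨_, x''⟩ : Σ b, T.E b) = ⟨_, Φ.ψ _ x⟩ →
      (⟨_, T.join (Φ.φ b) β' h' ⟨y, cast (by rw [← hβ2]) (Φ.ψ _ x)⟩⟩ : Σ b, T.E b) =
        ⟨_, T.join (Φ.φ b) β' h' ⟨z, x''⟩⟩ := by
    rintro z x'' rfl hz
    refine T.join_congr (fun _ => rfl) (Eq.trans ?_ hz.symm)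
    exact Sigma.ext (hβ2 _).symm (cast_heq _ _)
  refine Eq.trans (T.join_congr hβ2 ?_) (key _ x' (Equiv.apply_symm_apply _ _) hx)
  exact Sigma.ext (hβ2 _) (cast_heq _ _).symm

end CartMor

/-- A `J`-coloured `T`-operation: an operation `op` of `T` ("corolla") with a colour in
`δ⁻¹(s e)` for each of its incoming edges `e`. -/
structure Corolla {I J : Type u} (T : PolyMonad I) (δ : J → I) where
  op : T.B
  col : T.E op → J
  hcol : ∀ e, δ (col e) = T.s e

namespace Corolla

variable {I J : Type u} {T : PolyMonad I} {δ : J → I}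

theorem ext' {a a' : Corolla T δ} (h : a.op = a'.op)
    (h' : ∀ e e', (⟨a.op, e⟩ : Σ b, T.E b) = ⟨a'.op, e'⟩ → a.col e = a'.col e') : a = a' := by
  obtain ⟨b, c, hc⟩ := a
  obtain ⟨b', c', hc'⟩ := a'
  obtain rfl : b = b' := h
  obtain rfl : c = c' := funext fun e => h' e e rfl
  rfl

theorem col_congr {a a' : Corolla T δ} (h : a = a') {e : T.E a.op} {e' : T.E a'.op}
    (he : (⟨a.op, e⟩ : Σ b, T.E b) = ⟨a'.op, e'⟩) : a.col e = a'.col e' := by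
  subst h
  obtain rfl : e = e' := by simpa using he
  rfl

end Corolla

/-- For a `J`-coloured `T`-operation `a`: a family of `S`-operations, one for each edge of `a`,
whose targets are the colours of the edges of `a`. -/
structure OpFamily {I J : Type u} {S : PolyMonad J} {T : PolyMonad I} {δ : J → I}
    (Φ : CartMor S T δ) (a : Corolla T δ) where
  d : T.E a.op → S.B
  hd : ∀ e, S.t (d e) = a.col e

namespace OpFamily

variable {I J : Type u} {S : PolyMonad J} {T : PolyMonad I} {δ : J → I} {Φ : CartMor S T δ}
  {a : Corolla T δ}

theorem ext' {F G : OpFamily Φ a} (h : ∀ e, F.d e = G.d e) : F = G := by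
  obtain ⟨d, hd⟩ := F
  obtain ⟨d', hd'⟩ := G
  obtain rfl : d = d' := funext h
  rfl

theorem t_φ_d (F : OpFamily Φ a) (e : T.E a.op) : T.t (Φ.φ (F.d e)) = T.s e := by
  rw [Φ.t_φ, F.hd, a.hcol]

/-- The right `S`-action `θ(a; (d e)_e)`: substitute the operations `φ (d e)` into `a`; the edges
of the result are coloured by the sources of the `S`-operations `d e`. -/
def theta (F : OpFamily Φ a) : Corolla T δ where
  op := T.mul a.op (fun e => Φ.φ (F.d e)) F.t_φ_d
  col x := S.s ((Φ.ψ _).symm ((T.join _ _ F.t_φ_d).symm x).2)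
  hcol x := by
    rw [← Φ.s_ψ, Equiv.apply_symm_apply, ← T.s_join _ _ F.t_φ_d, Equiv.apply_symm_apply]

/-- The edge of `θ(a; d)` given by an edge `e` of `a` and an edge `x` of `d e`. -/
def edge (F : OpFamily Φ a) (e : T.E a.op) (x : S.E (F.d e)) : T.E F.theta.op :=
  T.join _ _ F.t_φ_d ⟨e, Φ.ψ _ x⟩

theorem theta_col (F : OpFamily Φ a) (e : T.E a.op) (x : S.E (F.d e)) :
    F.theta.col (F.edge e x) = S.s x := by
  have key : ∀ y : Σ e : T.E a.op, T.E (Φ.φ (F.d e)), y = ⟨e, Φ.ψ _ x⟩ →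
      S.s ((Φ.ψ _).symm y.2) = S.s x := by
    rintro y rfl
    simp
  exact key _ (by simp [edge])

theorem edge_surj (F : OpFamily Φ a) (z : T.E F.theta.op) : ∃ e x, F.edge e x = z := by
  obtain ⟨⟨e, y⟩, rfl⟩ := (T.join _ _ F.t_φ_d).surjective z
  refine ⟨e, (Φ.ψ _).symm y, ?_⟩
  rw [edge, Equiv.apply_symm_apply]

variable (Φ a) in
/-- The family of unit operations. -/
def id : OpFamily Φ a where
  d e := S.one (a.col e)
  hd _ := S.t_one _

/-- Substitution of families. -/
def comp (F : OpFamily Φ a) (G : OpFamily Φ F.theta) : OpFamily Φ a where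
  d e := S.mul (F.d e) (fun x => G.d (F.edge e x)) (fun x => by rw [G.hd, F.theta_col])
  hd e := by rw [S.t_mul, F.hd]

theorem edge_id (e : T.E a.op) (x : S.E (S.one (a.col e))) :
    (⟨_, (id Φ a).edge e x⟩ : Σ b, T.E b) = ⟨a.op, e⟩ := by
  have h1 : ∀ e, Φ.φ (S.one (a.col e)) = T.one (T.s e) := fun e => by rw [Φ.φ_one, a.hcol]
  rw [← T.join_one a.op e default]
  refine T.join_congr h1 ?_
  have : ∀ (b : T.B) (y : T.E b) (h : b = T.one (T.s e)),
      (⟨b, y⟩ : Σ b, T.E b) = ⟨T.one (T.s e), default⟩ := by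
    rintro b y rfl
    rw [Subsingleton.elim y default]
  exact this _ _ (h1 e)

theorem theta_id : (id Φ a).theta = a := by
  refine Corolla.ext' ?_ ?_
  · refine Eq.trans (T.mul_congr ?_) (T.mul_one a.op)
    intro e
    simp [id, Φ.φ_one, a.hcol]
  · intro z e' hz
    obtain ⟨e, x, rfl⟩ := edge_surj _ z
    rw [theta_col]
    have := (edge_id e x).symm.trans hz
    obtain rfl : e = e' := by simpa using this
    exact S.s_one _ x

theorem comp_op (F : OpFamily Φ a) (G : OpFamily Φ F.theta) :
    (F.comp G).theta.op = G.theta.op :=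
  Eq.trans (T.mul_congr fun _ => Φ.φ_mul' fun _ => rfl) (T.mul_assoc'
      (γ := fun e e' => Φ.φ (G.d (T.join _ _ F.t_φ_d ⟨e, e'⟩)))
      (fun _ _ => (G.t_φ_d _).trans (T.s_join _ _ F.t_φ_d _)) (fun _ _ => rfl)).symm

theorem comp_h (F : OpFamily Φ a) (G : OpFamily Φ F.theta) (e : T.E a.op) (x : S.E (F.d e)) :
    S.t (G.d (F.edge e x)) = S.s x := by
  rw [G.hd, F.theta_col]

theorem comp_edge (F : OpFamily Φ a) (G : OpFamily Φ F.theta) (e : T.E a.op) (x : S.E (F.d e))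
    (x' : S.E (G.d (F.edge e x))) :
    (⟨_, (F.comp G).edge e (S.join _ _ (F.comp_h G e) ⟨x, x'⟩)⟩ : Σ b, T.E b) =
      ⟨_, G.edge (F.edge e x) x'⟩ := by
  have h1 := T.join_assoc' (h := F.t_φ_d) (h' := G.t_φ_d)
      (γ := fun e e' => Φ.φ (G.d (T.join _ _ F.t_φ_d ⟨e, e'⟩)))
      (fun _ _ => (G.t_φ_d _).trans (T.s_join _ _ F.t_φ_d _)) (fun _ _ => rfl)
      (e := e) (e' := Φ.ψ _ x) (x := Φ.ψ _ x') rfl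
  refine Eq.trans (T.join_congr (fun _ => Φ.φ_mul' fun _ => rfl) ?_) h1.symm
  exact Φ.ψ_join' (fun _ => rfl) rfl

theorem theta_comp (F : OpFamily Φ a) (G : OpFamily Φ F.theta) :
    (F.comp G).theta = G.theta := by
  refine Corolla.ext' (F.comp_op G) fun z z' hz => ?_
  obtain ⟨y, x', rfl⟩ := G.edge_surj z'
  obtain ⟨e, x, rfl⟩ := F.edge_surj y
  have := hz.trans (F.comp_edge G e x x').symm
  obtain rfl : z = (F.comp G).edge e (S.join _ _ (F.comp_h G e) ⟨x, x'⟩) := by simpa using this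
  exact (theta_col _ _ _).trans ((S.s_join _ _ _ _).trans (theta_col _ _ _).symm)

theorem cast_d {a a' : Corolla T δ} (h : a = a') (F : OpFamily Φ a) {e : T.E a.op}
    {e' : T.E a'.op} (he : (⟨_, e⟩ : Σ b, T.E b) = ⟨_, e'⟩) : (h ▸ F).d e' = F.d e := by
  subst h
  obtain rfl : e = e' := by simpa using he
  rfl

theorem comp_id (F : OpFamily Φ a) : F.comp (id Φ F.theta) = F :=
  ext' fun e => (S.mul_congr fun x => congrArg S.one (F.theta_col e x)).trans (S.mul_one (F.d e))

theorem id_comp (F : OpFamily Φ a) : (id Φ a).comp (theta_id.symm ▸ F) = F := by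
  refine ext' fun e => ?_
  have h : ∀ x : S.E (S.one (a.col e)), S.t (F.d e) = S.s x := fun x => by rw [F.hd, S.s_one]
  exact (S.mul_congr fun x => cast_d _ _ (edge_id e x).symm).trans (S.one_mul _ _ h)

theorem comp_assoc (F : OpFamily Φ a) (G : OpFamily Φ F.theta) (H : OpFamily Φ G.theta) :
    (F.comp G).comp ((F.theta_comp G).symm ▸ H) = F.comp (G.comp H) :=
  ext' fun e => S.mul_assoc' (γ := fun x x' => H.d (G.edge (F.edge e x) x'))
    (fun x x' => by rw [H.hd, G.theta_col]) fun x x' => cast_d _ _ (F.comp_edge G e x x').symm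

end OpFamily

/-- A morphism `a' ⟶ a` of the classifier `T^S` is a family `d` of `S`-operations indexed by the
edges of `a`, with targets the colours of these edges, such that `a' = θ(a; d)`. -/
def CorollaHom {I J : Type u} {S : PolyMonad J} {T : PolyMonad I} {δ : J → I}
    (Φ : CartMor S T δ) (a' a : Corolla T δ) : Type u :=
  { F : OpFamily Φ a // F.theta = a' }

namespace CorollaHom

variable {I J : Type u} {S : PolyMonad J} {T : PolyMonad I} {δ : J → I} {Φ : CartMor S T δ}

/-- Composition of morphisms: substitute the operations of `f` into those of `g`. -/
def comp {a₁ a₂ a₃ : Corolla T δ} (f : CorollaHom Φ a₁ a₂) (g : CorollaHom Φ a₂ a₃) :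
    CorollaHom Φ a₁ a₃ :=
  ⟨g.1.comp (g.2.symm ▸ f.1), by
    obtain ⟨G, rfl⟩ := g
    exact (G.theta_comp f.1).trans f.2⟩

variable (Φ) in
/-- The identity morphism, given by the unit operations. -/
def id (a : Corolla T δ) : CorollaHom Φ a a := ⟨OpFamily.id Φ a, OpFamily.theta_id⟩

theorem id_comp {a' a : Corolla T δ} (f : CorollaHom Φ a' a) : (id Φ a').comp f = f := by
  obtain ⟨F, rfl⟩ := f
  exact Subtype.ext F.comp_id

theorem comp_id {a' a : Corolla T δ} (f : CorollaHom Φ a' a) : f.comp (id Φ a) = f :=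
  Subtype.ext f.1.id_comp

theorem assoc {a₁ a₂ a₃ a₄ : Corolla T δ} (f : CorollaHom Φ a₁ a₂) (g : CorollaHom Φ a₂ a₃)
    (h : CorollaHom Φ a₃ a₄) : (f.comp g).comp h = f.comp (g.comp h) := by
  obtain ⟨H, rfl⟩ := h
  obtain ⟨G, rfl⟩ := g
  obtain ⟨F, rfl⟩ := f
  exact Subtype.ext (H.comp_assoc G F).symm

end CorollaHom

/-- The internal `S`-algebra classifier `T^S` of `T`, as the total category of the `I`-indexed
collection of categories `(T^S)_i`. Its objects are the `J`-coloured `T`-operations. -/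
structure AlgClassifier {I J : Type u} {S : PolyMonad J} {T : PolyMonad I} {δ : J → I}
    (Φ : CartMor S T δ) where
  corolla : Corolla T δ

instance {I J : Type u} {S : PolyMonad J} {T : PolyMonad I} {δ : J → I} (Φ : CartMor S T δ) :
    Category.{u} (AlgClassifier Φ) where
  Hom a' a := CorollaHom Φ a'.corolla a.corolla
  id a := CorollaHom.id Φ a.corolla
  comp f g := f.comp g
  id_comp f := f.id_comp
  comp_id f := f.comp_id
  assoc f g h := f.assoc g h

/-- An operation of a monad of `T`-algebras with extra data, over the set of colours `I × C`: a
`T`-operation `op` with a colour in `C` for each incoming edge and a colour `out` for the outgoing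
edge, subject to a condition `Adm`. -/
structure ColouredOp {I : Type u} (T : PolyMonad I) {C : Type}
    (Adm : ∀ b : T.B, (T.E b → C) → C → Prop) where
  op : T.B
  col : T.E op → C
  out : C
  adm : Adm op col out

namespace ColouredOp

variable {I : Type u} {T : PolyMonad I} {C : Type} {Adm : ∀ b : T.B, (T.E b → C) → C → Prop}

theorem ext' {a a' : ColouredOp T Adm} (h : a.op = a'.op)
    (h' : ∀ e e', (⟨a.op, e⟩ : Σ b, T.E b) = ⟨a'.op, e'⟩ → a.col e = a'.col e')
    (ho : a.out = a'.out) : a = a' := by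
  obtain ⟨b, c, o, _⟩ := a
  obtain ⟨b', c', o', _⟩ := a'
  obtain rfl : b = b' := h
  obtain rfl : c = c' := funext fun e => h' e e rfl
  obtain rfl : o = o' := ho
  rfl

theorem sigma_ext {a a' : ColouredOp T Adm} (h : a = a') {e : T.E a.op} {e' : T.E a'.op}
    (he : (⟨a.op, e⟩ : Σ b, T.E b) = ⟨a'.op, e'⟩) :
    (⟨a, e⟩ : Σ a : ColouredOp T Adm, T.E a.op) = ⟨a', e'⟩ := by
  subst h
  obtain rfl : e = e' := by simpa using he
  rfl

end ColouredOp

namespace PolyMonad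

variable {I : Type u} (T : PolyMonad I)

/-- The condition `Adm` on `C`-coloured corollas holds for units and is closed under
substitution. -/
structure IsSubmonad {C : Type} (Adm : ∀ b : T.B, (T.E b → C) → C → Prop) : Prop where
  one : ∀ i j, Adm (T.one i) (fun _ => j) j
  mul : ∀ b β h c (γ : ∀ e, T.E (β e) → C) j, Adm b c j → (∀ e, Adm (β e) (γ e) (c e)) →
    Adm (T.mul b β h) (fun x => γ _ ((T.join b β h).symm x).2) j

variable {T} {C : Type} {Adm : ∀ b : T.B, (T.E b → C) → C → Prop}

/-- Substitution of coloured corollas. -/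
def IsSubmonad.subst (H : T.IsSubmonad Adm) (a : ColouredOp T Adm)
    (β : T.E a.op → ColouredOp T Adm) (h : ∀ e, T.t (β e).op = T.s e)
    (h' : ∀ e, (β e).out = a.col e) : ColouredOp T Adm where
  op := T.mul a.op (fun e => (β e).op) h
  col x := (β _).col ((T.join _ _ h).symm x).2
  out := a.out
  adm := H.mul _ (fun e => (β e).op) h a.col (fun e => (β e).col) _ a.adm fun e => by
    rw [← h' e]; exact (β e).adm

theorem IsSubmonad.subst_col (H : T.IsSubmonad Adm) (a : ColouredOp T Adm)
    (β : T.E a.op → ColouredOp T Adm) (h : ∀ e, T.t (β e).op = T.s e)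
    (h' : ∀ e, (β e).out = a.col e) (p : Σ e, T.E (β e).op) :
    (H.subst a β h h').col (T.join a.op (fun e => (β e).op) h p) = (β p.1).col p.2 := by
  have key : ∀ q, q = p → (β q.1).col q.2 = (β p.1).col p.2 := by rintro q rfl; rfl
  exact key _ (Equiv.symm_apply_apply _ _)

theorem IsSubmonad.mul_one (H : T.IsSubmonad Adm) (a : ColouredOp T Adm) :
    H.subst a (fun e => ⟨T.one (T.s e), fun _ => a.col e, a.col e, H.one _ _⟩)
      (fun _ => T.t_one _) (fun _ => rfl) = a := by
  refine ColouredOp.ext' (T.mul_one _) (fun z e hz => ?_) rfl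
  obtain ⟨⟨e', x⟩, rfl⟩ := (T.join a.op (fun e => T.one (T.s e)) (fun _ => T.t_one _)).surjective z
  have := (T.join_one a.op e' x).symm.trans hz
  obtain rfl : e' = e := by simpa using this
  exact H.subst_col _ _ _ _ _

theorem IsSubmonad.one_mul (H : T.IsSubmonad Adm) (i : I) (a : ColouredOp T Adm)
    (h : ∀ e : T.E (T.one i), T.t a.op = T.s e) :
    H.subst ⟨T.one i, fun _ => a.out, a.out, H.one _ _⟩ (fun _ => a) h (fun _ => rfl) = a := by
  refine ColouredOp.ext' (T.one_mul _ _ h) (fun z e hz => ?_) rfl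
  obtain ⟨⟨e', x⟩, rfl⟩ := (T.join (T.one i) (fun _ => a.op) h).surjective z
  have := (T.one_join i a.op h e' x).symm.trans hz
  obtain rfl : x = e := by simpa using this
  exact H.subst_col _ _ _ _ _

theorem IsSubmonad.mul_assoc (H : T.IsSubmonad Adm) (a : ColouredOp T Adm)
    (β : T.E a.op → ColouredOp T Adm) (h : ∀ e, T.t (β e).op = T.s e)
    (h' : ∀ e, (β e).out = a.col e) (γ : ∀ e, T.E (β e).op → ColouredOp T Adm)
    (k : ∀ e e', T.t (γ e e').op = T.s e') (k' : ∀ e e', (γ e e').out = (β e).col e') (l l') :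
    H.subst (H.subst a β h h')
        (fun x => γ _ ((T.join a.op (fun e => (β e).op) h).symm x).2) l l' =
      H.subst a (fun e => H.subst (β e) (γ e) (k e) (k' e))
        (fun e => (T.t_mul _ _ _).trans (h e)) h' := by
  refine ColouredOp.ext' (T.mul_assoc a.op _ h (fun e e' => (γ e e').op) k) (fun z z' hz => ?_) rfl
  obtain ⟨⟨x, e''⟩, rfl⟩ := (T.join _ _ l).surjective z
  have := (T.join_assoc a.op _ h (fun e e' => (γ e e').op) k x e'').symm.trans hz
  obtain rfl := eq_of_heq (Sigma.mk.inj this).2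
  refine (H.subst_col _ _ l l' _).trans ?_
  refine Eq.trans ?_ (H.subst_col a (fun e => H.subst (β e) (γ e) (k e) (k' e))
    (fun e => (T.t_mul _ _ _).trans (h e)) h' ⟨_, _⟩).symm
  exact (H.subst_col (β _) (γ _) (k _) (k' _) ⟨_, _⟩).symm

/-- The polynomial monad on `Set/(I × C)` whose operations are the `C`-coloured corollas
satisfying `Adm`; substitution of corollas is that of `T`. -/
def IsSubmonad.monad (H : T.IsSubmonad Adm) : PolyMonad (I × C) where
  B := ColouredOp T Adm
  E a := T.E a.op
  finite_E _ := inferInstance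
  s {a} e := (T.s e, a.col e)
  t a := (T.t a.op, a.out)
  one j := ⟨T.one j.1, fun _ => j.2, j.2, H.one _ _⟩
  t_one j := by simp [T.t_one]
  uniqueE _ := inferInstance
  s_one j e := by simp [T.s_one]
  mul a β h := H.subst a β (fun e => congrArg Prod.fst (h e)) (fun e => congrArg Prod.snd (h e))
  t_mul a β h := Prod.ext (T.t_mul _ _ _) rfl
  join a β h := T.join a.op (fun e => (β e).op) (fun e => congrArg Prod.fst (h e))
  s_join a β h x := Prod.ext (T.s_join _ _ _ _) (H.subst_col _ _ _ (fun e => congrArg Prod.snd (h e)) _)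
  mul_one a := H.mul_one a
  join_one a e e' := ColouredOp.sigma_ext (H.mul_one a) (T.join_one a.op e e')
  one_mul i a h := by
    obtain ⟨i, j⟩ := i
    obtain rfl : a.out = j := congrArg Prod.snd (h default)
    exact H.one_mul i a _
  one_join i a h e e' := by
    obtain ⟨i, j⟩ := i
    obtain rfl : a.out = j := congrArg Prod.snd (h default)
    exact ColouredOp.sigma_ext (H.one_mul i a _) (T.one_join i a.op _ e e')
  mul_assoc a β h γ k := H.mul_assoc a β (fun e => congrArg Prod.fst (h e))
    (fun e => congrArg Prod.snd (h e)) γ (fun e e' => congrArg Prod.fst (k e e'))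
    (fun e e' => congrArg Prod.snd (k e e')) _
    (fun x => (congrArg Prod.snd (k _ ((T.join _ _ _).symm x).2)))
  join_assoc a β h γ k x e'' := ColouredOp.sigma_ext
    (H.mul_assoc a β (fun e => congrArg Prod.fst (h e))
      (fun e => congrArg Prod.snd (h e)) γ (fun e e' => congrArg Prod.fst (k e e'))
      (fun e e' => congrArg Prod.snd (k e e')) _
      (fun x => (congrArg Prod.snd (k _ ((T.join _ _ _).symm x).2))))
    (T.join_assoc a.op _ _ (fun e e' => (γ e e').op) (fun e e' => congrArg Prod.fst (k e e')) x e'')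

/-- The cartesian morphism from `H.monad` to `T` which forgets the colours. -/
def IsSubmonad.forget (H : T.IsSubmonad Adm) : CartMor H.monad T (Prod.fst : I × C → I) where
  φ := ColouredOp.op
  ψ _ := Equiv.refl _
  s_ψ _ _ := rfl
  t_φ _ := rfl
  φ_one _ := rfl
  φ_mul _ _ _ := rfl
  ψ_join _ _ _ _ _ := rfl

variable (T)

/-- The operations of `T + (C ∖ {x₀})`: corollas all of whose edges have colour `x₀`, and unit
corollas whose two edges have the same colour `≠ x₀`. -/
def PlusAdm {C : Type} (x₀ : C) (b : T.B) (c : T.E b → C) (j : C) : Prop :=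
  (∀ e, c e = j) ∧ (j = x₀ ∨ ∃ i, b = T.one i)

theorem isUnit_mul {b : T.B} {β : T.E b → T.B} {h} (hb : ∃ i, b = T.one i)
    (hβ : ∀ e, ∃ i, β e = T.one i) : ∃ i, T.mul b β h = T.one i := by
  obtain ⟨i, rfl⟩ := hb
  refine ⟨i, (T.mul_congr fun e => ?_).trans (T.mul_one _)⟩
  obtain ⟨i', hi'⟩ := hβ e
  have := h e
  rw [hi', T.t_one] at this
  rw [hi', this]

theorem plusAdm_isSubmonad {C : Type} (x₀ : C) : T.IsSubmonad (T.PlusAdm x₀) where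
  one i j := ⟨fun _ => rfl, Or.inr ⟨i, rfl⟩⟩
  mul b β h c γ j hb hβ := by
    refine ⟨fun x => ((hβ _).1 _).trans (hb.1 _), ?_⟩
    by_cases hj : j = x₀
    · exact Or.inl hj
    · refine Or.inr (T.isUnit_mul (hb.2.resolve_left hj) fun e => (hβ e).2.resolve_left ?_)
      rw [hb.1 e]
      exact hj

/-- The two colours for the semi-free coproduct of a `T`-algebra `X` and a free algebra on `K`. -/
inductive Colour₂
  | X | K

/-- The three colours for free `T`-algebra extensions. -/
inductive Colour₃
  | X | K | L

/-- The operations of `T_{f,g}`: corollas with outgoing colour `X` and incoming colours in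
`{X, K}` (operations of the algebra `X`, and for units the operation `g : K → X`);
the units `K → K`; the units `L → L` and the unit corollas `K → L` (the operation `f`). -/
def FGAdm (b : T.B) (c : T.E b → Colour₃) : Colour₃ → Prop
  | .X => ∀ e, c e ≠ .L
  | .K => (∃ i, b = T.one i) ∧ ∀ e, c e = .K
  | .L => (∃ i, b = T.one i) ∧ ∀ e, c e ≠ .X

theorem fgAdm_isSubmonad : T.IsSubmonad T.FGAdm where
  one i j := by cases j <;> simp [FGAdm]
  mul b β h c γ j hb hβ := by
    have key : ∀ e, (c e = .X → ∀ e', γ e e' ≠ .L) ∧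
        (c e = .K → (∃ i, β e = T.one i) ∧ ∀ e', γ e e' = .K) ∧
        (c e = .L → (∃ i, β e = T.one i) ∧ ∀ e', γ e e' ≠ .X) := fun e =>
      ⟨fun h => by simpa [h, FGAdm] using hβ e, fun h => by simpa [h, FGAdm] using hβ e,
        fun h => by simpa [h, FGAdm] using hβ e⟩
    cases j with
    | X =>
      intro x
      show γ _ ((T.join b β h).symm x).2 ≠ .L
      generalize (T.join b β h).symm x = p
      have h1 := hb p.1
      have h2 := key p.1
      cases hc : c p.1 with
      | X => exact h2.1 hc _
      | K => simp [(h2.2.1 hc).2]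
      | L => exact absurd hc h1
    | K =>
      exact ⟨T.isUnit_mul hb.1 fun e => ((key e).2.1 (hb.2 e)).1,
        fun x => ((key _).2.1 (hb.2 _)).2 _⟩
    | L =>
      refine ⟨T.isUnit_mul hb.1 fun e => ?_, fun x => ?_⟩
      · cases hc : c e with
        | X => exact absurd hc (hb.2 e)
        | K => exact ((key e).2.1 hc).1
        | L => exact ((key e).2.2 hc).1
      · show γ _ ((T.join b β h).symm x).2 ≠ .X
        generalize (T.join b β h).symm x = p
        cases hc : c p.1 with
        | X => exact absurd hc (hb.2 _)
        | K => simp [((key p.1).2.1 hc).2]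
        | L => exact ((key p.1).2.2 hc).2 _

/-- The polynomial monad `T + 1` on `Set/(I ⊔ I)`. -/
abbrev plusOne : PolyMonad (I × Colour₂) := (T.plusAdm_isSubmonad Colour₂.X).monad

/-- The polynomial monad `T + 2` on `Set/(I ⊔ I ⊔ I)`. -/
abbrev plusTwo : PolyMonad (I × Colour₃) := (T.plusAdm_isSubmonad Colour₃.X).monad

/-- The polynomial monad `T_{f,g}` on `Set/(I ⊔ I ⊔ I)`. -/
abbrev freeExt : PolyMonad (I × Colour₃) := T.fgAdm_isSubmonad.monad

/-- The classifier `T^{T+1}` for semi-free coproducts. -/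
abbrev SemiFreeClassifier : Type u :=
  AlgClassifier (S := T.plusOne) (T.plusAdm_isSubmonad Colour₂.X).forget

/-- The classifier `T^{T+2}`. -/
abbrev PlusTwoClassifier : Type u :=
  AlgClassifier (S := T.plusTwo) (T.plusAdm_isSubmonad Colour₃.X).forget

/-- The classifier `T^{T_{f,g}}` for free algebra extensions. -/
abbrev FreeExtClassifier : Type u :=
  AlgClassifier (S := T.freeExt) T.fgAdm_isSubmonad.forget

end PolyMonad

/-- A category is a coproduct of categories with terminal object: each of its connected
components has a terminal object. -/
def IsCoproductOfTerminal (C : Type u) [Category.{v} C] : Prop :=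
  ∀ c : ConnectedComponents C, HasTerminal c.Component

namespace PolyMonad

variable {I : Type u} (T : PolyMonad I)

/-- `T` is tame if `T^{T+1}` is a coproduct of categories with terminal object. -/
def Tame : Prop := IsCoproductOfTerminal T.SemiFreeClassifier

/-- A choice of a terminal object in each connected component of `T^{T+2}`. -/
structure TerminalChoice where
  obj : ∀ c : ConnectedComponents T.PlusTwoClassifier, c.Component
  isTerminal : ∀ c, IsTerminal (obj c)

variable {T}

/-- The number of `K`-edges of an object of `T^{T_{f,g}}`. -/
noncomputable def numK (a : T.FreeExtClassifier) : ℕ :=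
  Nat.card { e : T.E a.corolla.op // (a.corolla.col e).2 = Colour₃.K }

/-- The number of `L`-edges of an object of `T^{T_{f,g}}`. -/
noncomputable def numL (a : T.FreeExtClassifier) : ℕ :=
  Nat.card { e : T.E a.corolla.op // (a.corolla.col e).2 = Colour₃.L }

/-- The degree of an object of `T^{T_{f,g}}`. -/
noncomputable def degree (a : T.FreeExtClassifier) : ℕ := numK a + numL a

namespace TerminalChoice

variable (τ : T.TerminalChoice)

/-- The objects of the full subcategory `t` of `T^{T_{f,g}}`: the chosen objects. Recall that
`T^{T+2}` and `T^{T_{f,g}}` have the same objects. -/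
def t : ObjectProperty T.FreeExtClassifier := fun a => ∃ c, (τ.obj c).obj.corolla = a.corolla

/-- The objects of `t` of degree at most `k`. -/
def tLE (k : ℕ) : ObjectProperty T.FreeExtClassifier := fun a => τ.t a ∧ degree a ≤ k

/-- The objects of `t` of degree `k`. -/
def w (k : ℕ) : ObjectProperty T.FreeExtClassifier := fun a => τ.t a ∧ degree a = k

/-- The objects of `t` of degree `k` with at least one `K`-edge. -/
def q (k : ℕ) : ObjectProperty T.FreeExtClassifier := fun a => τ.w k a ∧ numK a ≠ 0

/-- The objects of `t` of degree `k` without `K`-edges. -/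
def l (k : ℕ) : ObjectProperty T.FreeExtClassifier := fun a => τ.w k a ∧ numK a = 0

/-- The objects of `t` of degree at most `k` which do not belong to `l k`. -/
def qBar (k : ℕ) : ObjectProperty T.FreeExtClassifier := fun a => τ.tLE k a ∧ ¬ τ.l k a

theorem tLE_mono {j k : ℕ} (h : j ≤ k) : τ.tLE j ≤ τ.tLE k := fun _ ha => ⟨ha.1, ha.2.trans h⟩

theorem q_le_w (k : ℕ) : τ.q k ≤ τ.w k := fun _ ha => ha.1

theorem l_le_w (k : ℕ) : τ.l k ≤ τ.w k := fun _ ha => ha.1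

theorem l_le_tLE (k : ℕ) : τ.l k ≤ τ.tLE k := fun _ ha => ⟨ha.1.1, ha.1.2.le⟩

theorem q_le_qBar (k : ℕ) : τ.q k ≤ τ.qBar k := fun _ ha =>
  ⟨⟨ha.1.1, ha.1.2.le⟩, fun hl => ha.2 hl.2⟩

theorem tLE_le_qBar (k : ℕ) : τ.tLE k ≤ τ.qBar (k + 1) := fun a ha =>
  ⟨τ.tLE_mono k.le_succ a ha, fun hl => by have h1 := ha.2; have h2 := hl.1.2; omega⟩

end TerminalChoice

end PolyMonad

section RestrictedColimits

variable {C : Type u} [Category.{u} C] {D : Type w} [Category.{v} D] [HasColimitsOfSize.{u, u} D]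

/-- The colimit of the restriction of `X` to the full subcategory of objects satisfying `P`. -/
noncomputable abbrev colimOn (X : C ⥤ D) (P : ObjectProperty C) : D := colimit (P.ι ⋙ X)

/-- The canonical map between colimits over full subcategories. -/
noncomputable def colimOnMap (X : C ⥤ D) {P Q : ObjectProperty C} (h : P ≤ Q) :
    colimOn X P ⟶ colimOn X Q :=
  colimit.pre (Q.ι ⋙ X) (ObjectProperty.ιOfLE h)

/-- The canonical map from the colimit over a full subcategory to the colimit. -/
noncomputable def colimOnDesc (X : C ⥤ D) (P : ObjectProperty C) : colimOn X P ⟶ colimit X :=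
  colimit.pre X P.ι

theorem ι_colimOnMap (X : C ⥤ D) {P Q : ObjectProperty C} (h : P ≤ Q) (a : P.FullSubcategory) :
    colimit.ι (P.ι ⋙ X) a ≫ colimOnMap X h = colimit.ι (Q.ι ⋙ X) ⟨a.obj, h _ a.property⟩ :=
  colimit.ι_pre (Q.ι ⋙ X) (ObjectProperty.ιOfLE h) a

theorem ι_colimOnDesc (X : C ⥤ D) (P : ObjectProperty C) (a : P.FullSubcategory) :
    colimit.ι (P.ι ⋙ X) a ≫ colimOnDesc X P = colimit.ι X a.obj :=
  colimit.ι_pre X P.ι a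

/-- The sequence of colimits of `X` over an increasing sequence of full subcategories. -/
noncomputable def colimOnSeq (X : C ⥤ D) (P : ℕ → ObjectProperty C)
    (hP : ∀ {j k}, j ≤ k → P j ≤ P k) : ℕ ⥤ D where
  obj k := colimOn X (P k)
  map f := colimOnMap X (hP (leOfHom f))
  map_id k := colimit.hom_ext fun a => by
    rw [ι_colimOnMap]; exact (Category.comp_id _).symm
  map_comp f g := colimit.hom_ext fun a => by
    refine (ι_colimOnMap X _ a).trans (Eq.trans ?_ (Category.assoc _ _ _))
    refine Eq.trans ?_ (congrArg (· ≫ _) (ι_colimOnMap X (hP (leOfHom f)) a).symm)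
    exact (ι_colimOnMap X (hP (leOfHom g)) ⟨a.obj, hP (leOfHom f) _ a.property⟩).symm

/-- The canonical cocone with vertex `colim X` under this sequence. -/
noncomputable def colimOnCocone (X : C ⥤ D) (P : ℕ → ObjectProperty C)
    (hP : ∀ {j k}, j ≤ k → P j ≤ P k) : Cocone (colimOnSeq X P hP) where
  pt := colimit X
  ι :=
    { app := fun k => colimOnDesc X (P k)
      naturality := fun j k f => colimit.hom_ext fun a => by
        refine (Category.assoc _ _ _).symm.trans ?_
        refine (congrArg (· ≫ colimOnDesc X (P k)) (ι_colimOnMap X (hP (leOfHom f)) a)).trans ?_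
        refine (ι_colimOnDesc X _ _).trans ?_
        refine (ι_colimOnDesc X (P j) a).symm.trans ?_
        exact congrArg (colimit.ι ((P j).ι ⋙ X) a ≫ ·) (Category.comp_id _).symm }

end RestrictedColimits

/-! A morphism of a classifier is a substitution of operations of `T` subject to conditions on
colours, and it induces a map on edges. In `T^{T+2}` this map preserves colours, and each `K`- or
`L`-edge of the target has exactly one preimage. In `T^{T_{f,g}}` the second property persists, but
a `K`-edge may also become an `L`-edge (apply `f`) or end in an `X`-edge (apply `g`). So a morphism
of `T^{T_{f,g}}` is a recolouring of `K`-edges followed by a morphism of `T^{T+2}`.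

Since the chosen objects are terminal in their components, the morphisms from `a` to objects of `t`
correspond to the recolourings of the `K`-edges of `a` (`exists_hom_recolour`, `hom_ext_pull`), and
factorisations are detected on colours (`existsUnique_factor`). Everything else is combinatorics of
recolourings.

Keeping all colours gives a reflection onto `t`, so `colim X` is a colimit over `t`, the union of
the `t^(k)`. Degree never rises and falls exactly when a `K`-edge becomes `X`. Hence every morphism
of `t^(k)` lies in `w^(k)` or in `qBar^(k)`, whose intersection is `q^(k)`, and the colimit over
`t^(k)` is a pushout. Turning every `K` into `L` reflects `w^(k)` onto `l^(k)`; the inclusion of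
`t^(k-1)` in `qBar^(k)` is final because the recolourings turning some `K` into `X` form a connected
category (`final_tLE`). Within `w^(k)` only changes from `K` to `L` remain, and the
`K`/`L`-colourings of the non-`X` edges of an object of `l^(k)` form a cube (`pull_hom_vertex`).

Terminal objects for `T+2` come from tameness by merging `K` and `L`: over non-`X` edges morphisms
are bijective, so the distinction can be carried along to a terminal object of `T^{T+1}`. -/

namespace PolyMonad

/-! ### Classifier morphisms as substitutions with conditions on colours. -/

variable {I : Type u} {T : PolyMonad I}

/-- A presentation of the operation `b'` as a substitution of operations into `b`. -/
structure Substitution (T : PolyMonad I) (b' b : T.B) where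
  β : T.E b → T.B
  h : ∀ e, T.t (β e) = T.s e
  eq : T.mul b β h = b'

namespace Substitution

variable {b' b : T.B}

/-- The edges of a substitution are the edges of the substituted operations. -/
def joinE (σ : T.Substitution b' b) : (Σ e, T.E (σ.β e)) ≃ T.E b' :=
  (T.join b σ.β σ.h).trans (Equiv.cast (congrArg T.E σ.eq))

/-- The edge of `b` from which an edge of `b'` arises. -/
def edge (σ : T.Substitution b' b) (y : T.E b') : T.E b := (σ.joinE.symm y).1

@[simp]
theorem edge_joinE (σ : T.Substitution b' b) (p : Σ e, T.E (σ.β e)) :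
    σ.edge (σ.joinE p) = p.1 := by
  simp [edge]

theorem exists_joinE (σ : T.Substitution b' b) (y : T.E b') :
    ∃ x : T.E (σ.β (σ.edge y)), σ.joinE ⟨_, x⟩ = y :=
  ⟨(σ.joinE.symm y).2, σ.joinE.apply_symm_apply y⟩

theorem sigma_joinE (σ : T.Substitution b' b) (p : Σ e, T.E (σ.β e)) :
    (⟨_, σ.joinE p⟩ : Σ b, T.E b) = ⟨_, T.join b σ.β σ.h p⟩ := by
  obtain ⟨β, h, rfl⟩ := σ
  rfl

theorem existsUnique_edge (σ : T.Substitution b' b) {e : T.E b} (he : ∃ i, σ.β e = T.one i) :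
    ∃! y, σ.edge y = e := by
  obtain ⟨i, hi⟩ := he
  have hU : Unique (T.E (σ.β e)) := by rw [hi]; infer_instance
  refine ⟨σ.joinE ⟨e, default⟩, by simp, fun y hy => ?_⟩
  obtain ⟨x, hx⟩ := σ.exists_joinE y
  subst hy
  rw [Subsingleton.elim x default] at hx
  exact hx.symm

end Substitution

section Classifier

variable {C : Type} {Adm : ∀ b : T.B, (T.E b → C) → C → Prop} {H : T.IsSubmonad Adm}

/-- The `C`-colour of an edge of an object of a classifier over `I × C`. -/
def clr {S : PolyMonad (I × C)} {Φ : CartMor S T Prod.fst} (a : AlgClassifier Φ)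
    (e : T.E a.corolla.op) : C :=
  (a.corolla.col e).2

/-- The substitution underlying a morphism of a classifier. -/
def toSub {a' a : AlgClassifier (S := H.monad) H.forget} (f : a' ⟶ a) :
    T.Substitution a'.corolla.op a.corolla.op where
  β e := (f.1.d e).op
  h := f.1.t_φ_d
  eq := congrArg Corolla.op f.2

theorem sub_theta {a : Corolla T (Prod.fst : I × C → I)} (F : OpFamily H.forget a)
    (e : T.E a.op) (x : T.E (F.d e).op) :
    F.theta.col (T.join a.op (fun e => (F.d e).op) F.t_φ_d ⟨e, x⟩) =
      (T.s x, (F.d e).col x) :=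
  F.theta_col e x

theorem clr_joinE {a' a : AlgClassifier (S := H.monad) H.forget} (f : a' ⟶ a)
    (e : T.E a.corolla.op) (x : T.E (f.1.d e).op) :
    clr a' ((toSub f).joinE ⟨e, x⟩) = (f.1.d e).col x := by
  obtain ⟨a'⟩ := a'
  obtain ⟨F, hF⟩ := f
  dsimp at F hF
  subst hF
  exact congrArg Prod.snd (sub_theta F e x)

theorem adm_of_hom {a' a : AlgClassifier (S := H.monad) H.forget} (f : a' ⟶ a)
    (e : T.E a.corolla.op) :
    Adm ((toSub f).β e) (fun x => clr a' ((toSub f).joinE ⟨e, x⟩)) (clr a e) := by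
  have h1 := (f.1.d e).adm
  have h2 : (f.1.d e).out = clr a e := congrArg Prod.snd (f.1.hd e)
  rw [h2] at h1
  have h3 : (fun x => clr a' ((toSub f).joinE ⟨e, x⟩)) = (f.1.d e).col :=
    funext fun x => clr_joinE f e x
  rw [h3]
  exact h1

/-- The incoming colours of the substituted operations are read off from the source, the outgoing
ones from the target; only the underlying operations are free. -/
theorem toSub_injective {a' a : AlgClassifier (S := H.monad) H.forget} {f g : a' ⟶ a}
    (h : toSub f = toSub g) : f = g := by
  refine Subtype.ext (OpFamily.ext' fun e => ColouredOp.ext' ?_ ?_ ?_)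
  · exact congrArg (fun σ : T.Substitution _ _ => σ.β e) h
  · intro x x' hx
    rw [← clr_joinE f, ← clr_joinE g]
    have key : ∀ σ : T.Substitution a'.corolla.op a.corolla.op, toSub f = σ →
        ∀ x' : T.E (σ.β e), (⟨(toSub f).β e, x⟩ : Σ b, T.E b) = ⟨σ.β e, x'⟩ →
        clr a' ((toSub f).joinE ⟨e, x⟩) = clr a' (σ.joinE ⟨e, x'⟩) := by
      rintro σ rfl x' hx'
      obtain rfl : x = x' := eq_of_heq (Sigma.mk.inj hx').2
      rfl
    exact key _ h x' hx
  · exact (congrArg Prod.snd (f.1.hd e)).trans (congrArg Prod.snd (g.1.hd e)).symm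

/-- Converse of `adm_of_hom`: with `toSub_injective`, a morphism is the same thing as a substitution
whose pieces, coloured by source and target, are admissible. -/
theorem exists_hom_of_adm {a' a : AlgClassifier (S := H.monad) H.forget}
    (σ : T.Substitution a'.corolla.op a.corolla.op)
    (h : ∀ e, Adm (σ.β e) (fun x => clr a' (σ.joinE ⟨e, x⟩)) (clr a e)) :
    ∃ f : a' ⟶ a, toSub f = σ := by
  obtain ⟨⟨b', c', hc'⟩⟩ := a'
  obtain ⟨β, hβ, hb⟩ := σ
  dsimp at hb
  subst hb
  let F : OpFamily H.forget a.corolla :=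
    ⟨fun e => ⟨β e, _, _, h e⟩, fun e => Prod.ext ((hβ e).trans (a.corolla.hcol e).symm) rfl⟩
  refine ⟨⟨F, Corolla.ext' rfl fun z z' hz => ?_⟩, rfl⟩
  obtain rfl : z = z' := eq_of_heq (Sigma.mk.inj hz).2
  obtain ⟨⟨e, x⟩, rfl⟩ := (T.join _ _ F.t_φ_d).surjective z
  refine (sub_theta F e x).trans (Prod.ext ?_ rfl)
  exact (T.s_join _ _ hβ ⟨e, x⟩).symm.trans (hc' _).symm

/-- The effect of a morphism of a classifier on edges. -/
def edgeMap {a' a : AlgClassifier (S := H.monad) H.forget} (f : a' ⟶ a) :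
    T.E a'.corolla.op → T.E a.corolla.op :=
  (toSub f).edge

/-- Stated in the total set of edges, so that it applies to identities and composites, where the
operations agree only up to a propositional equality. -/
theorem edgeMap_eq {a' a : AlgClassifier (S := H.monad) H.forget} (f : a' ⟶ a)
    {e : T.E a.corolla.op} (x : T.E (f.1.d e).op) {y : T.E a'.corolla.op}
    (h : (⟨_, f.1.edge e x⟩ : Σ b, T.E b) = ⟨_, y⟩) : edgeMap f y = e := by
  have h1 : (toSub f).joinE ⟨e, x⟩ = y := by
    have := ((toSub f).sigma_joinE ⟨e, x⟩).trans h
    simpa using this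
  rw [← h1]
  exact (toSub f).edge_joinE _

@[simp]
theorem edgeMap_id (a : AlgClassifier (S := H.monad) H.forget) (y : T.E a.corolla.op) :
    edgeMap (𝟙 a) y = y :=
  edgeMap_eq (𝟙 a) (default : T.E (T.one (a.corolla.col y).1)) (OpFamily.edge_id (Φ := H.forget) y _)

@[simp]
theorem edgeMap_comp {a₁ a₂ a₃ : AlgClassifier (S := H.monad) H.forget} (f : a₁ ⟶ a₂)
    (g : a₂ ⟶ a₃) (y : T.E a₁.corolla.op) : edgeMap (f ≫ g) y = edgeMap g (edgeMap f y) := by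
  obtain ⟨a₂⟩ := a₂
  obtain ⟨G, hG⟩ := g
  dsimp at G hG
  subst hG
  obtain ⟨a₁⟩ := a₁
  obtain ⟨F, hF⟩ := f
  dsimp at F hF
  subst hF
  obtain ⟨z, x', rfl⟩ := F.edge_surj y
  obtain ⟨e, x, rfl⟩ := G.edge_surj z
  have h1 := edgeMap_eq (a' := ⟨F.theta⟩) (a := ⟨G.theta⟩) ⟨F, rfl⟩ x' rfl
  have h2 := edgeMap_eq (a' := ⟨G.theta⟩) (a := a₃) ⟨G, rfl⟩ x rfl
  refine Eq.trans ?_ ((congrArg _ h1).trans h2).symm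
  exact edgeMap_eq (a' := ⟨F.theta⟩) (a := a₃) (e := e) ⟨G.comp F, G.theta_comp F⟩
    (H.monad.join _ _ (G.comp_h F e) ⟨x, x'⟩) (G.comp_edge F e x x')

end Classifier

end PolyMonad

/-! ### Morphisms for `T+1`, `T+2` and `T_{f,g}` in terms of edges and colours. -/

namespace PolyMonad

variable {I : Type u} {T : PolyMonad I}

theorem Colour₃.eq_K_or_X {c : Colour₃} (h : c ≠ .L) : c = .K ∨ .X = c := by
  cases c <;> simp at h ⊢

theorem Colour₃.eq_K_or_L {c : Colour₃} (h : c ≠ .X) : c = .K ∨ .L = c := by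
  cases c <;> simp at h ⊢

section Plus

variable {C : Type} {x₀ : C}

theorem clr_plus {a' a : AlgClassifier (S := (T.plusAdm_isSubmonad x₀).monad)
    (T.plusAdm_isSubmonad x₀).forget} (f : a' ⟶ a) (y : T.E a'.corolla.op) :
    clr a (edgeMap f y) = clr a' y := by
  obtain ⟨x, hx⟩ := (toSub f).exists_joinE y
  have := (adm_of_hom f (edgeMap f y)).1 x
  exact this.symm.trans (congrArg _ hx)

theorem isUnit_plus {a' a : AlgClassifier (S := (T.plusAdm_isSubmonad x₀).monad)
    (T.plusAdm_isSubmonad x₀).forget} (f : a' ⟶ a) {e : T.E a.corolla.op} (he : clr a e ≠ x₀) :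
    ∃ i, (toSub f).β e = T.one i :=
  (adm_of_hom f e).2.resolve_left he

theorem existsUnique_plus {a' a : AlgClassifier (S := (T.plusAdm_isSubmonad x₀).monad)
    (T.plusAdm_isSubmonad x₀).forget} (f : a' ⟶ a) {e : T.E a.corolla.op} (he : clr a e ≠ x₀) :
    ∃! y, edgeMap f y = e :=
  (toSub f).existsUnique_edge (isUnit_plus f he)

theorem exists_plus_hom {a' a : AlgClassifier (S := (T.plusAdm_isSubmonad x₀).monad)
    (T.plusAdm_isSubmonad x₀).forget} (σ : T.Substitution a'.corolla.op a.corolla.op)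
    (h : ∀ y, clr a (σ.edge y) = clr a' y)
    (h' : ∀ e, clr a e ≠ x₀ → ∃ i, σ.β e = T.one i) : ∃ f : a' ⟶ a, toSub f = σ := by
  refine exists_hom_of_adm σ fun e => ⟨fun x => ?_, or_iff_not_imp_left.2 (h' e)⟩
  exact (h _).symm.trans (congrArg _ (σ.edge_joinE _))

end Plus

section FreeExt

variable {a' a : T.FreeExtClassifier}

/-- The only operations of `T_{f,g}` relating different colours are those with a `K`-input and
output `X` or `L`. -/
theorem clr_freeExt (f : a' ⟶ a) (y : T.E a'.corolla.op) :
    clr a' y = .K ∨ clr a (edgeMap f y) = clr a' y := by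
  obtain ⟨x, hx⟩ := (toSub f).exists_joinE y
  have h1 := adm_of_hom f (edgeMap f y)
  have h2 : clr a' ((toSub f).joinE ⟨edgeMap f y, x⟩) = clr a' y := congrArg _ hx
  rw [← h2]
  generalize clr a (edgeMap f y) = c at h1
  cases c with
  | X => exact Colour₃.eq_K_or_X (h1 x)
  | K => exact Or.inl (h1.2 x)
  | L => exact Colour₃.eq_K_or_L (h1.2 x)

theorem isUnit_freeExt (f : a' ⟶ a) {e : T.E a.corolla.op} (he : clr a e ≠ .X) :
    ∃ i, (toSub f).β e = T.one i := by
  have h1 := adm_of_hom f e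
  generalize clr a e = c at h1 he
  cases c with
  | X => exact absurd rfl he
  | K => exact h1.1
  | L => exact h1.1

theorem existsUnique_freeExt (f : a' ⟶ a) {e : T.E a.corolla.op} (he : clr a e ≠ .X) :
    ∃! y, edgeMap f y = e :=
  (toSub f).existsUnique_edge (isUnit_freeExt f he)

theorem exists_freeExt_hom (σ : T.Substitution a'.corolla.op a.corolla.op)
    (h : ∀ y, clr a' y = .K ∨ clr a (σ.edge y) = clr a' y)
    (h' : ∀ e, clr a e ≠ .X → ∃ i, σ.β e = T.one i) : ∃ f : a' ⟶ a, toSub f = σ := by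
  refine exists_hom_of_adm σ fun e => ?_
  have h1 : ∀ x, clr a' (σ.joinE ⟨e, x⟩) = .K ∨ clr a e = clr a' (σ.joinE ⟨e, x⟩) := fun x => by
    simpa using h (σ.joinE ⟨e, x⟩)
  have h2 := h' e
  generalize clr a e = c at h1 h2
  cases c with
  | X => exact fun x => by rcases h1 x with h | h; exacts [by simp [h], by simp [← h]]
  | K => exact ⟨h2 (by simp), fun x => (h1 x).elim id Eq.symm⟩
  | L =>
    exact ⟨h2 (by simp), fun x => by rcases h1 x with h | h; exacts [by simp [h], by simp [← h]]⟩

end FreeExt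

/-- The object of a classifier given by an operation and a colouring of its edges. -/
abbrev colouring {C : Type} {S : PolyMonad (I × C)} (Φ : CartMor S T Prod.fst) (b : T.B)
    (ρ : T.E b → C) : AlgClassifier Φ :=
  ⟨⟨b, fun e => (T.s e, ρ e), fun _ => rfl⟩⟩

theorem colouring_clr {C : Type} {S : PolyMonad (I × C)} {Φ : CartMor S T Prod.fst}
    (a : AlgClassifier Φ) : colouring Φ a.corolla.op (clr a) = a := by
  obtain ⟨⟨b, c, hc⟩⟩ := a
  have : (fun e => (T.s e, (c e).2)) = c := funext fun e => Prod.ext (hc e).symm rfl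
  simp only [colouring, clr, this]

/-- The colour of the semi-free coproduct obtained by merging `K` and `L`. -/
def mergeKL : Colour₃ → Colour₂
  | .X => .X
  | .K => .K
  | .L => .K

theorem mergeKL_eq_X {c : Colour₃} : mergeKL c = .X ↔ c = .X := by cases c <;> simp [mergeKL]

/-- Merge the colours `K` and `L` of an object of `T^{T+2}`. -/
abbrev merge (a : T.PlusTwoClassifier) : T.SemiFreeClassifier :=
  colouring _ a.corolla.op fun e => mergeKL (clr a e)

/-- Merging is functorial because it leaves the substitution untouched and `mergeKL` reflects the
colour `X`. -/
theorem exists_merge_hom {a' a : T.PlusTwoClassifier} (f : a' ⟶ a) :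
    ∃ g : merge a' ⟶ merge a, edgeMap g = edgeMap f ∧ toSub g = (toSub f :) := by
  obtain ⟨g, hg⟩ := exists_plus_hom (a' := merge a') (a := merge a) (toSub f :)
    (fun y => congrArg mergeKL (clr_plus f y))
    (fun e he => isUnit_plus f fun h => he (mergeKL_eq_X.2 h))
  exact ⟨g, congrArg Substitution.edge hg, hg⟩

end PolyMonad

/-! ### Terminal objects in the components of `T^{T+2}`. -/

section Components

variable {C : Type u} [Category.{v} C]

theorem component_eq_of_hom {a b : C} (f : a ⟶ b) :
    CategoryTheory.ConnectedComponents.mk a = .mk b :=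
  Quotient.sound (s := Zigzag.setoid C) (Zigzag.of_hom f)

theorem exists_terminal_target (h : IsCoproductOfTerminal C) (a : C) :
    ∃ z : C, Nonempty (a ⟶ z) ∧
      ∀ y, CategoryTheory.ConnectedComponents.mk y = .mk a → Nonempty (Unique (y ⟶ z)) := by
  have := h (.mk a)
  let z := terminal (CategoryTheory.ConnectedComponents.mk a).Component
  have key : ∀ y, CategoryTheory.ConnectedComponents.mk y = .mk a →
      Nonempty (Unique (y ⟶ z.obj)) := fun y hy =>
    let y' : (CategoryTheory.ConnectedComponents.mk a).Component := ⟨y, hy⟩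
    ⟨⟨⟨(terminal.from y').hom⟩, fun f =>
      congrArg InducedCategory.Hom.hom
        (terminal.hom_ext (ObjectProperty.homMk f : y' ⟶ z) (terminal.from y'))⟩⟩
  exact ⟨z.obj, ⟨(key a rfl).some.default⟩, key⟩

end Components

namespace PolyMonad

variable {I : Type u} {T : PolyMonad I}

theorem merge_colouring (z : T.SemiFreeClassifier) (ρ : T.E z.corolla.op → Colour₃)
    (h : ∀ e, mergeKL (ρ e) = clr z e) : merge (colouring _ z.corolla.op ρ) = z := by
  conv_rhs => rw [← colouring_clr z]
  exact congrArg _ (funext h)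

/-- A morphism to the terminal object of a component of `T^{T+1}` lifts to `T^{T+2}`. -/
theorem exists_colouring_hom (a : T.PlusTwoClassifier) {z : T.SemiFreeClassifier}
    (f : merge a ⟶ z) : ∃ (z' : T.PlusTwoClassifier) (_ : merge z' = z), Nonempty (a ⟶ z') := by
  have hu : ∀ e, clr z e ≠ .X → ∃! y, edgeMap f y = e := fun e he => existsUnique_plus f he
  classical
  -- A non-`X` edge of `z` inherits the colour of its unique preimage in `a`.
  let ρ : T.E z.corolla.op → Colour₃ := fun e =>
    if h : clr z e ≠ .X then clr a (hu e h).choose else .X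
  have hρ : ∀ y, ρ (edgeMap f y) = clr a y := fun y => by
    have h1 : clr z (edgeMap f y) = mergeKL (clr a y) := clr_plus f y
    by_cases h : clr z (edgeMap f y) = .X
    · simp only [ρ, h]
      rw [h1, mergeKL_eq_X] at h
      simp [h]
    · simp only [ρ, dif_pos h]
      exact congrArg _ ((hu _ h).choose_spec.2 y rfl).symm
  have hm : ∀ e, mergeKL (ρ e) = clr z e := fun e => by
    by_cases h : clr z e = .X
    · simp [ρ, h, mergeKL]
    · obtain ⟨y, rfl⟩ := (hu e h).exists
      rw [hρ]
      exact (clr_plus f y).symm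
  refine ⟨colouring _ z.corolla.op ρ, merge_colouring z ρ hm, ?_⟩
  obtain ⟨g, -⟩ := exists_plus_hom (a' := a)
    (a := colouring (T.plusAdm_isSubmonad Colour₃.X).forget z.corolla.op ρ) (toSub f :) hρ
    (fun e he => isUnit_plus f fun h => he (mergeKL_eq_X.1 ((hm e).trans h)))
  exact ⟨g⟩

theorem hom_unique_of_merge {y z : T.PlusTwoClassifier} (h : Subsingleton (merge y ⟶ merge z)) :
    Subsingleton (y ⟶ z) := by
  refine ⟨fun f g => toSub_injective ?_⟩
  obtain ⟨f', -, hf⟩ := exists_merge_hom f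
  obtain ⟨g', -, hg⟩ := exists_merge_hom g
  rw [Subsingleton.elim f' g'] at hf
  exact hf.symm.trans hg

/-- A priori `ν` may confuse `K` and `L`. But each non-`X` edge of `y'` comes from `y` along `μ`,
and uniqueness of morphisms `merge y ⟶ merge z` forces `μ` followed by `ν` to act on edges as `f`,
which preserves the three colours. -/
theorem nonempty_hom_of_merge {y y' z : T.PlusTwoClassifier} (f : y ⟶ z) (μ : y ⟶ y')
    (ν : merge y' ⟶ merge z) [Subsingleton (merge y ⟶ merge z)] : Nonempty (y' ⟶ z) := by
  obtain ⟨f', hf, -⟩ := exists_merge_hom f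
  obtain ⟨μ', hμ, -⟩ := exists_merge_hom μ
  have key : ∀ x : T.E y.corolla.op, edgeMap ν (edgeMap μ x :) = (edgeMap f x :) := fun x => by
    rw [← hf, ← hμ, Subsingleton.elim f' (μ' ≫ ν), edgeMap_comp]
  have hc : ∀ e, clr z (edgeMap ν e :) = clr y' e := fun e => by
    by_cases h : clr y' e = .X
    · rw [h, ← mergeKL_eq_X]
      exact (clr_plus ν e).trans (mergeKL_eq_X.2 h)
    · obtain ⟨x, rfl⟩ := (existsUnique_plus μ h).exists
      exact (congrArg _ (key x)).trans ((clr_plus f x).trans (clr_plus μ x).symm)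
  exact ⟨(exists_plus_hom (a' := y') (a := z) (toSub ν :) hc
    fun e he => isUnit_plus ν fun h => he (mergeKL_eq_X.1 h)).choose⟩

theorem exists_terminal_plusTwo (hT : T.Tame) (a : T.PlusTwoClassifier) :
    ∃ z : T.PlusTwoClassifier, Nonempty (a ⟶ z) ∧
      ∀ y, CategoryTheory.ConnectedComponents.mk y = .mk a → Nonempty (Unique (y ⟶ z)) := by
  obtain ⟨z, ⟨f⟩, hz⟩ := exists_terminal_target hT (merge a)
  obtain ⟨z, rfl, ⟨g⟩⟩ := exists_colouring_hom a f
  have hcomp : ∀ {y y' : T.PlusTwoClassifier}, (y ⟶ y') →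
      CategoryTheory.ConnectedComponents.mk (merge y) = .mk (merge y') := fun h =>
    component_eq_of_hom (exists_merge_hom h).choose
  -- A morphism to `z` is transported along each step of a zigzag: backwards steps by composition,
  -- forward steps by `nonempty_hom_of_merge`.
  have key : ∀ y, Zigzag a y → CategoryTheory.ConnectedComponents.mk (merge y) = .mk (merge a) ∧
      Nonempty (y ⟶ z) := by
    intro y hy
    induction hy with
    | refl => exact ⟨rfl, ⟨g⟩⟩
    | tail _ h ih =>
      obtain ⟨ih1, ⟨k⟩⟩ := ih
      rcases h with ⟨⟨h⟩⟩ | ⟨⟨h⟩⟩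
      · have h1 := (hcomp h).symm.trans ih1
        obtain ⟨u⟩ := hz _ ih1
        obtain ⟨u'⟩ := hz _ h1
        exact ⟨h1, nonempty_hom_of_merge k h u'.default⟩
      · exact ⟨(hcomp h).trans ih1, ⟨h ≫ k⟩⟩
  refine ⟨z, ⟨g⟩, fun y hy => ?_⟩
  obtain ⟨h1, ⟨k⟩⟩ := key y (Quotient.exact hy.symm)
  obtain ⟨u⟩ := hz _ h1
  have := hom_unique_of_merge (y := y) (z := z) inferInstance
  exact ⟨⟨⟨k⟩, fun _ => Subsingleton.elim _ _⟩⟩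

theorem nonempty_terminalChoice (hT : T.Tame) : Nonempty T.TerminalChoice := by
  have key : ∀ c : CategoryTheory.ConnectedComponents T.PlusTwoClassifier,
      ∃ z : c.Component, Nonempty (IsTerminal z) := by
    intro c
    obtain ⟨a, rfl⟩ := Quotient.exists_rep c
    obtain ⟨z, ⟨g⟩, hz⟩ := exists_terminal_plusTwo hT a
    refine ⟨⟨z, (component_eq_of_hom g).symm⟩, ⟨?_⟩⟩
    have : ∀ y : (CategoryTheory.ConnectedComponents.mk a).Component,
      Nonempty (Unique (y.obj ⟶ z)) := fun y => hz _ y.property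
    exact IsTerminal.ofUniqueHom (fun y => ObjectProperty.homMk (this y).some.default)
      fun y m => InducedCategory.hom_ext ((this y).some.uniq _)
  choose z hz using key
  exact ⟨⟨z, fun c => (hz c).some⟩⟩

end PolyMonad

/-! ### Morphisms into chosen objects as recolourings; behaviour of the degree. -/

namespace PolyMonad

variable {I : Type u} {T : PolyMonad I}

/-- An object of `T^{T_{f,g}}` as an object of `T^{T+2}`. -/
abbrev toPlusTwo (a : T.FreeExtClassifier) : T.PlusTwoClassifier := ⟨a.corolla⟩

/-- Change the colours of the edges of an object of `T^{T_{f,g}}`. -/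
abbrev recolour (a : T.FreeExtClassifier) (ρ : T.E a.corolla.op → Colour₃) :
    T.FreeExtClassifier :=
  colouring _ a.corolla.op ρ

/-- The pullback of the colours of the target of a morphism. -/
def pull {a z : T.FreeExtClassifier} (f : a ⟶ z) (x : T.E a.corolla.op) : Colour₃ :=
  clr z (edgeMap f x)

@[simp]
theorem pull_comp {a y z : T.FreeExtClassifier} (f : a ⟶ y) (g : y ⟶ z)
    (x : T.E a.corolla.op) : pull (f ≫ g) x = pull g (edgeMap f x) := by
  simp [pull]

theorem clr_or_pull {a z : T.FreeExtClassifier} (f : a ⟶ z) (x : T.E a.corolla.op) :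
    clr a x = .K ∨ pull f x = clr a x :=
  clr_freeExt f x

theorem pull_eq_X {a z : T.FreeExtClassifier} (f : a ⟶ z) {x : T.E a.corolla.op}
    (hx : clr a x = .X) : pull f x = .X :=
  ((clr_or_pull f x).resolve_left (by simp [hx])).trans hx

/-- Once the source carries the colours pulled back from the target, the same substitution preserves
colours. This splits any morphism of `T^{T_{f,g}}` into a recolouring and a morphism of `T^{T+2}`.
-/
theorem exists_plusTwo_hom_of_pull {a z : T.FreeExtClassifier} (f : a ⟶ z)
    {ρ : T.E a.corolla.op → Colour₃} (hρ : ∀ x, pull f x = ρ x) :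
    ∃ g : toPlusTwo (recolour a ρ) ⟶ toPlusTwo z, toSub g = (toSub f :) :=
  exists_plus_hom (a' := toPlusTwo (recolour a ρ)) (a := toPlusTwo z) (toSub f :)
    hρ fun _ he => isUnit_freeExt f he

section Degree

variable {a b : T.FreeExtClassifier}

theorem numK_eq (a : T.FreeExtClassifier) :
    numK a = Nat.card { e : T.E a.corolla.op // clr a e = .K } := rfl

theorem degree_eq (a : T.FreeExtClassifier) :
    degree a = Nat.card { e : T.E a.corolla.op // clr a e ≠ .X } := by
  have h : ∀ e, clr a e ≠ .X ↔ clr a e = .K ∨ clr a e = .L := fun e => by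
    cases clr a e <;> simp
  classical
  rw [Nat.card_congr (Equiv.subtypeEquivRight h),
    Nat.card_congr (subtypeOrEquiv (fun e => clr a e = .K) (fun e => clr a e = .L) ?_), Nat.card_sum]
  · rfl
  · rw [Pi.disjoint_iff]
    intro e
    cases clr a e <;> simp

/-- Excluding `X` makes the edge map bijective onto the edges counted, so invariants of the target
can be computed on the edges of the source. -/
theorem card_clr_eq (f : a ⟶ b) {p : Colour₃ → Prop} (hp : ¬ p .X) :
    Nat.card { e : T.E b.corolla.op // p (clr b e) } =
      Nat.card { x : T.E a.corolla.op // p (pull f x) } := by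
  refine (Nat.card_congr (Equiv.ofBijective (fun x => ⟨edgeMap f x.1, x.2⟩) ⟨?_, ?_⟩)).symm
  · rintro ⟨x, hx⟩ ⟨y, hy⟩ hxy
    have h : edgeMap f x = edgeMap f y := congrArg Subtype.val hxy
    exact Subtype.ext ((existsUnique_freeExt f (fun h => hp (h ▸ hy))).unique h rfl)
  · rintro ⟨e, he⟩
    obtain ⟨x, rfl⟩ := (existsUnique_freeExt f (e := e) (fun h => hp (h ▸ he))).exists
    exact ⟨⟨x, he⟩, rfl⟩

theorem numK_target (f : a ⟶ b) :
    numK b = Nat.card { x : T.E a.corolla.op // pull f x = .K } :=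
  card_clr_eq f (p := (· = .K)) (by simp)

theorem degree_target (f : a ⟶ b) :
    degree b = Nat.card { x : T.E a.corolla.op // pull f x ≠ .X } :=
  (degree_eq b).trans (card_clr_eq f (p := (· ≠ .X)) (by simp))

theorem degree_le (f : a ⟶ b) : degree b ≤ degree a := by
  rw [degree_target f, degree_eq]
  exact Nat.card_mono (Set.toFinite {x | clr a x ≠ .X}) fun x hx h => hx (pull_eq_X f h)

/-- The edges with non-`X` image form a subset of the non-`X` edges of `a`; for finite sets, equal
cardinality means equality. -/
theorem degree_eq_iff (f : a ⟶ b) :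
    degree b = degree a ↔ ∀ x, clr a x ≠ .X → pull f x ≠ .X := by
  have h0 : {x | pull f x ≠ .X} ⊆ {x | clr a x ≠ .X} := fun x hx h => hx (pull_eq_X f h)
  rw [degree_target f, degree_eq]
  constructor
  · intro h x hx
    have := Set.eq_of_subset_of_ncard_le h0 (Eq.ge h) (Set.toFinite _)
    exact (Set.ext_iff.1 this x).2 hx
  · intro h
    exact congrArg (fun s : Set _ => Nat.card s) (Set.Subset.antisymm h0 h)

theorem numK_eq_zero (a : T.FreeExtClassifier) : numK a = 0 ↔ ∀ e, clr a e ≠ .K := by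
  rw [numK_eq, Finite.card_eq_zero_iff, isEmpty_subtype]

theorem numK_target_eq_zero (f : a ⟶ b) : numK b = 0 ↔ ∀ x, pull f x ≠ .K := by
  rw [numK_target f, Finite.card_eq_zero_iff, isEmpty_subtype]

end Degree

namespace TerminalChoice

variable (τ : T.TerminalChoice)

/-- The chosen object in the component of `T^{T+2}` of a given object. -/
def r (a : T.FreeExtClassifier) : T.FreeExtClassifier :=
  ⟨(τ.obj (.mk (toPlusTwo a))).obj.corolla⟩

theorem t_r (a : T.FreeExtClassifier) : τ.t (τ.r a) := ⟨_, rfl⟩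

variable {τ}

theorem r_eq_of_hom {a b : T.FreeExtClassifier} (f : toPlusTwo a ⟶ toPlusTwo b) :
    τ.r a = τ.r b := by
  unfold r
  rw [component_eq_of_hom f]

theorem r_eq_self {z : T.FreeExtClassifier} (hz : τ.t z) : τ.r z = z := by
  obtain ⟨c, hc⟩ := hz
  have h1 : (τ.obj c).obj = toPlusTwo z := congrArg AlgClassifier.mk hc
  have h2 : CategoryTheory.ConnectedComponents.mk (τ.obj c).obj = c := (τ.obj c).property
  rw [h1] at h2
  unfold r
  rw [h2, h1]

variable (τ) in
theorem nonempty_hom_r (a : T.FreeExtClassifier) :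
    Nonempty (toPlusTwo a ⟶ toPlusTwo (τ.r a)) :=
  ⟨((τ.isTerminal _).from (⟨toPlusTwo a, rfl⟩ :
    (CategoryTheory.ConnectedComponents.mk (toPlusTwo a)).Component)).hom⟩

theorem subsingleton_hom {z : T.FreeExtClassifier} (hz : τ.t z) (y : T.PlusTwoClassifier) :
    Subsingleton (y ⟶ toPlusTwo z) := by
  obtain ⟨c, hc⟩ := hz
  obtain ⟨z⟩ := z
  dsimp at hc
  subst hc
  refine ⟨fun f g => ?_⟩
  have hy : CategoryTheory.ConnectedComponents.mk y = c :=
    (component_eq_of_hom f).trans (τ.obj c).property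
  exact congrArg InducedCategory.Hom.hom ((τ.isTerminal c).hom_ext
    (ObjectProperty.homMk f : (⟨y, hy⟩ : c.Component) ⟶ τ.obj c) (ObjectProperty.homMk g))

/-- A morphism to a chosen object is determined by its effect on colours. -/
theorem hom_ext_pull {a z : T.FreeExtClassifier} (hz : τ.t z) {f g : a ⟶ z}
    (h : ∀ x, pull f x = pull g x) : f = g := by
  refine toSub_injective ?_
  obtain ⟨f', hf⟩ := exists_plusTwo_hom_of_pull f h
  obtain ⟨g', hg⟩ := exists_plusTwo_hom_of_pull g fun _ => rfl
  have := subsingleton_hom hz (toPlusTwo (recolour a (pull g)))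
  rw [Subsingleton.elim f' g'] at hf
  exact hf.symm.trans hg

/-- An equality of objects, not merely an isomorphism, because each component contains exactly one
chosen object. -/
theorem eq_r_of_hom {a z : T.FreeExtClassifier} (hz : τ.t z) (f : a ⟶ z) :
    z = τ.r (recolour a (pull f)) := by
  rw [r_eq_of_hom (exists_plusTwo_hom_of_pull f fun _ => rfl).choose, r_eq_self hz]

variable (τ) in
-- Existence half of the correspondence between recolourings of `K`-edges and morphisms into `t`;
-- `hom_ext_pull` is the uniqueness half.
theorem exists_hom_recolour (a : T.FreeExtClassifier) (ρ : T.E a.corolla.op → Colour₃)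
    (h : ∀ x, clr a x = .K ∨ ρ x = clr a x) :
    ∃ f : a ⟶ τ.r (recolour a ρ), ∀ x, pull f x = ρ x := by
  obtain ⟨g⟩ := τ.nonempty_hom_r (recolour a ρ)
  have hg : ∀ x : T.E a.corolla.op, clr (τ.r (recolour a ρ)) (edgeMap g x :) = ρ x :=
    fun x => clr_plus g x
  obtain ⟨f, hf⟩ := exists_freeExt_hom (a' := a) (a := τ.r (recolour a ρ)) (toSub g :)
    (fun x => (h x).imp_right (hg x).trans) fun e he => isUnit_plus g he
  refine ⟨f, fun x => ?_⟩
  rw [pull, edgeMap, hf]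
  exact hg x

/-- A morphism `f : a ⟶ z` factors through `h : a ⟶ y` if its effect on colours does. -/
theorem exists_factor {a y z : T.FreeExtClassifier} (hz : τ.t z) (h : a ⟶ y) (f : a ⟶ z)
    (hf : ∀ x, pull h x = .K ∨ pull f x = pull h x) : ∃ g : y ⟶ z, h ≫ g = f := by
  have hu : ∀ e, clr y e ≠ .X → ∃! x, edgeMap h x = e := fun e he => existsUnique_freeExt h he
  classical
  -- The colouring `pull f` descends along `h`: non-`X` edges of `y` have a unique preimage, and
  -- `X`-edges are forced to stay `X`.
  let ρ : T.E y.corolla.op → Colour₃ := fun e =>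
    if he : clr y e ≠ .X then pull f (hu e he).choose else .X
  have hX : ∀ e, clr y e = .X → ρ e = .X := fun e he => by simp [ρ, he]
  have hρ : ∀ x, ρ (edgeMap h x) = pull f x := fun x => by
    by_cases he : clr y (edgeMap h x) = .X
    · rw [hX _ he]
      have he' : pull h x = .X := he
      simpa [he', eq_comm] using hf x
    · simp only [ρ, dif_pos he]
      exact congrArg _ ((hu _ he).choose_spec.2 x rfl).symm
  have hle : ∀ e, clr y e = .K ∨ ρ e = clr y e := fun e => by
    by_cases he : clr y e = .X
    · exact Or.inr ((hX e he).trans he.symm)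
    · obtain ⟨x, rfl⟩ := (hu e he).exists
      rw [hρ]
      exact hf x
  -- With these colours `h` underlies a morphism of `T^{T+2}`, so both recoloured objects lie in the
  -- component of `z`.
  obtain ⟨k, -⟩ := exists_plus_hom (a' := toPlusTwo (recolour a (pull f)))
    (a := toPlusTwo (recolour y ρ)) (toSub h :) hρ
    fun e he => isUnit_freeExt h fun he' => he (hX e he')
  have hzr : z = τ.r (recolour y ρ) := (eq_r_of_hom hz f).trans (r_eq_of_hom k)
  obtain ⟨g, hg⟩ : ∃ g : y ⟶ z, ∀ e, pull g e = ρ e := by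
    rw [hzr]
    exact τ.exists_hom_recolour y ρ hle
  refine ⟨g, hom_ext_pull hz fun x => ?_⟩
  rw [pull_comp, hg, hρ]

/-- Every non-`X` edge of `y` is hit by `h`, and `X`-edges leave no choice, so the effect on colours
is determined after composing with `h`. -/
theorem cancel_left {a y z : T.FreeExtClassifier} (hz : τ.t z) (h : a ⟶ y) {g g' : y ⟶ z}
    (hg : h ≫ g = h ≫ g') : g = g' := by
  refine hom_ext_pull hz fun e => ?_
  by_cases he : clr y e = .X
  · rw [pull_eq_X g he, pull_eq_X g' he]
  · obtain ⟨x, rfl⟩ := (existsUnique_freeExt h he).exists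
    rw [← pull_comp, ← pull_comp, hg]

end TerminalChoice

end PolyMonad

/-! ### Colimits over full subcategories: finality, pushouts, exhaustions. -/

section RestrictedColimitLemmas

theorem isConnected_structuredArrow_of_universal {C : Type*} [Category* C] {D : Type*}
    [Category* D] {F : C ⥤ D} {d : D} {c : C} (η : d ⟶ F.obj c)
    (H : ∀ (c' : C) (f : d ⟶ F.obj c'), ∃! g : c ⟶ c', η ≫ F.map g = f) :
    IsConnected (StructuredArrow d F) := by
  have hI : IsInitial (StructuredArrow.mk η) :=
    IsInitial.ofUniqueHom (fun Y => StructuredArrow.homMk (H Y.right Y.hom).choose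
      (H Y.right Y.hom).choose_spec.1) fun Y m => StructuredArrow.hom_ext _ _
        ((H Y.right Y.hom).choose_spec.2 m.right (StructuredArrow.w m))
  exact isConnected_of_isInitial _ hI

variable {C : Type u} [Category.{u} C]

theorem final_ιOfLE_of_exists_universal {P Q : ObjectProperty C} (hPQ : P ≤ Q)
    (h : ∀ a, Q a → ∃ z, P z ∧ ∃ η : a ⟶ z, ∀ z', P z' → ∀ f : a ⟶ z', ∃! g, η ≫ g = f) :
    (ObjectProperty.ιOfLE hPQ).Final := by
  refine ⟨fun d => ?_⟩
  obtain ⟨z, hz, η, H⟩ := h d.obj d.property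
  let c : P.FullSubcategory := ⟨z, hz⟩
  let η' : d ⟶ (ObjectProperty.ιOfLE hPQ).obj c := ObjectProperty.homMk η
  refine isConnected_structuredArrow_of_universal η' fun c' f => ?_
  obtain ⟨g, hg, hg'⟩ := H c'.obj c'.property f.hom
  exact ⟨ObjectProperty.homMk g, InducedCategory.hom_ext hg,
    fun k hk => InducedCategory.hom_ext (hg' k.hom (congrArg InducedCategory.Hom.hom hk))⟩

variable {D : Type w} [Category.{v} D] [HasColimitsOfSize.{u, u} D] (X : C ⥤ D)

theorem isIso_colimOnMap {P Q : ObjectProperty C} (h : P ≤ Q) [(ObjectProperty.ιOfLE h).Final] :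
    IsIso (colimOnMap X h) :=
  inferInstanceAs (IsIso (colimit.pre _ _))

theorem isIso_colimOnMap_of_le {P Q : ObjectProperty C} (h : P ≤ Q) (h' : Q ≤ P) :
    IsIso (colimOnMap X h) := by
  refine ⟨colimOnMap X h', colimit.hom_ext fun a => ?_, colimit.hom_ext fun a => ?_⟩
  · rw [← Category.assoc, ι_colimOnMap, Category.comp_id]
    exact ι_colimOnMap X h' ⟨a.obj, h _ a.property⟩
  · rw [← Category.assoc, ι_colimOnMap, Category.comp_id]
    exact ι_colimOnMap X h ⟨a.obj, h' _ a.property⟩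

theorem colimOn_w {P : ObjectProperty C} {a b : C} (ha : P a) (hb : P b) (f : a ⟶ b) :
    X.map f ≫ colimit.ι (P.ι ⋙ X) ⟨b, hb⟩ = colimit.ι (P.ι ⋙ X) ⟨a, ha⟩ :=
  colimit.w (P.ι ⋙ X) (ObjectProperty.homMk f : (⟨a, ha⟩ : P.FullSubcategory) ⟶ ⟨b, hb⟩)

/-- A morphism out of the colimit over a full subcategory. -/
noncomputable def colimOnLift (P : ObjectProperty C) {Z : D} (φ : ∀ a, P a → (X.obj a ⟶ Z))
    (h : ∀ {a b} (ha : P a) (hb : P b) (f : a ⟶ b), X.map f ≫ φ b hb = φ a ha) :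
    colimOn X P ⟶ Z :=
  colimit.desc (P.ι ⋙ X)
    { pt := Z
      ι :=
        { app := fun a => φ a.obj a.property
          naturality := fun a b f =>
            (h a.property b.property f.hom).trans (Category.comp_id _).symm } }

theorem ι_colimOnLift (P : ObjectProperty C) {Z : D} (φ : ∀ a, P a → (X.obj a ⟶ Z))
    (h : ∀ {a b} (ha : P a) (hb : P b) (f : a ⟶ b), X.map f ≫ φ b hb = φ a ha)
    (a : P.FullSubcategory) :
    colimit.ι (P.ι ⋙ X) a ≫ colimOnLift X P φ h = φ a.obj a.property :=
  colimit.ι_desc _ _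

theorem colimOnMap_comp {P Q R : ObjectProperty C} (h : P ≤ Q) (h' : Q ≤ R) :
    colimOnMap X h ≫ colimOnMap X h' = colimOnMap X (h.trans h') := by
  refine colimit.hom_ext fun a => ?_
  rw [← Category.assoc, ι_colimOnMap]
  exact (ι_colimOnMap X h' ⟨a.obj, h _ a.property⟩).trans (ι_colimOnMap X (h.trans h') a).symm

/-- If a full subcategory is the union of two full subcategories such that every morphism lies in
one of them, then the colimit over it is the pushout over the intersection. -/
theorem isPushout_colimOnMap {Q W R U : ObjectProperty C} (hQW : Q ≤ W) (hQR : Q ≤ R)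
    (hWU : W ≤ U) (hRU : R ≤ U) (hQ : ∀ a, W a → R a → Q a)
    (hU : ∀ {a b}, U a → U b → (a ⟶ b) → (W a ∧ W b) ∨ (R a ∧ R b)) :
    IsPushout (colimOnMap X hQW) (colimOnMap X hQR) (colimOnMap X hWU) (colimOnMap X hRU) := by
  have hw : colimOnMap X hQW ≫ colimOnMap X hWU = colimOnMap X hQR ≫ colimOnMap X hRU := by
    rw [colimOnMap_comp, colimOnMap_comp]
  have key : ∀ {Z : D} (i : colimOn X W ⟶ Z) (j : colimOn X R ⟶ Z),
      colimOnMap X hQW ≫ i = colimOnMap X hQR ≫ j → ∃ l : colimOn X U ⟶ Z,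
        colimOnMap X hWU ≫ l = i ∧ colimOnMap X hRU ≫ l = j := by
    intro Z i j hij
    have hag : ∀ a (hW : W a) (hR : R a),
        colimit.ι (W.ι ⋙ X) ⟨a, hW⟩ ≫ i = colimit.ι (R.ι ⋙ X) ⟨a, hR⟩ ≫ j := fun a hW hR => by
      have h1 := ι_colimOnMap X hQW ⟨a, hQ a hW hR⟩
      have h2 := ι_colimOnMap X hQR ⟨a, hQ a hW hR⟩
      rw [← h1, ← h2, Category.assoc, Category.assoc, hij]
    have hex : ∀ a, U a → ∃ φ : X.obj a ⟶ Z,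
        (∀ hW : W a, colimit.ι (W.ι ⋙ X) ⟨a, hW⟩ ≫ i = φ) ∧
        (∀ hR : R a, colimit.ι (R.ι ⋙ X) ⟨a, hR⟩ ≫ j = φ) := fun a ha => by
      -- Applied to an identity, the hypothesis on morphisms says that each object lies in `W` or in
      -- `R`.
      rcases hU ha ha (𝟙 a) with ⟨hW, -⟩ | ⟨hR, -⟩
      · exact ⟨_, fun _ => rfl, fun hR => (hag a hW hR).symm⟩
      · exact ⟨_, fun hW => hag a hW hR, fun _ => rfl⟩
    choose φ hφW hφR using hex
    refine ⟨colimOnLift X U φ fun {a b} ha hb f => ?_, colimit.hom_ext fun a => ?_,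
      colimit.hom_ext fun a => ?_⟩
    · rcases hU ha hb f with ⟨h1, h2⟩ | ⟨h1, h2⟩
      · rw [← hφW b hb h2, ← hφW a ha h1, ← colimOn_w X h1 h2 f, Category.assoc]
      · rw [← hφR b hb h2, ← hφR a ha h1, ← colimOn_w X h1 h2 f, Category.assoc]
    · rw [← Category.assoc, ι_colimOnMap]
      exact (ι_colimOnLift X U φ _ ⟨a.obj, hWU _ a.property⟩).trans (hφW _ _ a.property).symm
    · rw [← Category.assoc, ι_colimOnMap]
      exact (ι_colimOnLift X U φ _ ⟨a.obj, hRU _ a.property⟩).trans (hφR _ _ a.property).symm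
  refine ⟨⟨hw⟩, ⟨PushoutCocone.IsColimit.mk hw (fun s => (key s.inl s.inr s.condition).choose)
    (fun s => (key s.inl s.inr s.condition).choose_spec.1)
    (fun s => (key s.inl s.inr s.condition).choose_spec.2) fun s m h1 h2 => ?_⟩⟩
  obtain ⟨h3, h4⟩ := (key s.inl s.inr s.condition).choose_spec
  refine colimit.hom_ext fun a => ?_
  rcases hU a.property a.property (𝟙 a.obj) with ⟨h, -⟩ | ⟨h, -⟩
  · rw [← ι_colimOnMap X hWU ⟨a.obj, h⟩, Category.assoc, Category.assoc, h1, h3]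
  · rw [← ι_colimOnMap X hRU ⟨a.obj, h⟩, Category.assoc, Category.assoc, h2, h4]

/-- The sequence exhausts `U`, and both ends of a morphism of `U` lie in a common stage; finality of
`U` identifies its colimit with `colimit X`. -/
theorem isColimit_colimOnCocone {U : ObjectProperty C} [U.ι.Final] (P : ℕ → ObjectProperty C)
    (hP : ∀ {j k}, j ≤ k → P j ≤ P k) (hPU : ∀ k, P k ≤ U) (hU : ∀ a, U a → ∃ k, P k a) :
    Nonempty (IsColimit (colimOnCocone X P hP)) := by
  have : IsIso (colimOnDesc X U) := inferInstanceAs (IsIso (colimit.pre _ _))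
  have key : ∀ {Z : D} (σ : ∀ k, colimOn X (P k) ⟶ Z),
      (∀ {j k} (h : j ≤ k), colimOnMap X (hP h) ≫ σ k = σ j) →
      ∃ l : colimit X ⟶ Z, ∀ k, colimOnDesc X (P k) ≫ l = σ k := by
    intro Z σ hσ
    let ψ : ∀ k a, P k a → (X.obj a ⟶ Z) := fun k a ha =>
      colimit.ι ((P k).ι ⋙ X) ⟨a, ha⟩ ≫ σ k
    have hle : ∀ {j k} (h : j ≤ k) a (ha : P j a), ψ k a (hP h a ha) = ψ j a ha := by
      intro j k h a ha
      simp only [ψ]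
      rw [← hσ h, ← Category.assoc, ι_colimOnMap]
    have hψ : ∀ {j k} a (ha : P j a) (ha' : P k a), ψ j a ha = ψ k a ha' := fun {j k} a ha ha' =>
      (hle (le_max_left j k) a ha).symm.trans (hle (le_max_right j k) a ha')
    choose d hd using hU
    let l : colimOn X U ⟶ Z := colimOnLift X U (fun a ha => ψ (d a ha) a (hd a ha))
      fun {a b} ha hb f => by
        have h1 := hP (le_max_left (d a ha) (d b hb)) a (hd a ha)
        have h2 := hP (le_max_right (d a ha) (d b hb)) b (hd b hb)
        rw [hψ a (hd a ha) h1, hψ b (hd b hb) h2]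
        simp only [ψ]
        rw [← colimOn_w X h1 h2 f, Category.assoc]
    refine ⟨inv (colimOnDesc X U) ≫ l, fun k => ?_⟩
    have h1 : colimOnDesc X (P k) = colimOnMap X (hPU k) ≫ colimOnDesc X U := by
      refine colimit.hom_ext fun a => ?_
      rw [← Category.assoc, ι_colimOnMap, ι_colimOnDesc]
      exact (ι_colimOnDesc X U ⟨a.obj, hPU k _ a.property⟩).symm
    rw [h1, Category.assoc, IsIso.hom_inv_id_assoc]
    refine colimit.hom_ext fun a => ?_
    rw [← Category.assoc, ι_colimOnMap]
    exact (ι_colimOnLift X U _ _ ⟨a.obj, hPU k _ a.property⟩).trans (hψ a.obj _ a.property)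
  have uniq : ∀ {Z : D} (m m' : colimit X ⟶ Z),
      (∀ k, colimOnDesc X (P k) ≫ m = colimOnDesc X (P k) ≫ m') → m = m' := by
    intro Z m m' hm
    rw [← cancel_epi (colimOnDesc X U)]
    refine colimit.hom_ext fun a => ?_
    obtain ⟨k, hk⟩ := hU a.obj a.property
    have h := congrArg (colimit.ι ((P k).ι ⋙ X) ⟨a.obj, hk⟩ ≫ ·) (hm k)
    simp only [← Category.assoc, ι_colimOnDesc] at h ⊢
    exact h
  have hs : ∀ s : Cocone (colimOnSeq X P hP), ∃ l : colimit X ⟶ s.pt,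
      ∀ k, (colimOnCocone X P hP).ι.app k ≫ l = s.ι.app k :=
    fun s => key (fun k => s.ι.app k) fun h => s.w (homOfLE h)
  exact ⟨⟨fun s => (hs s).choose, fun s k => (hs s).choose_spec k,
    fun s m hm => uniq m (hs s).choose fun k => (hm k).trans ((hs s).choose_spec k).symm⟩⟩

end RestrictedColimitLemmas

/-! ### The final inclusions and the pushout square. -/

namespace PolyMonad.TerminalChoice

variable {I : Type u} {T : PolyMonad I} (τ : T.TerminalChoice)

theorem existsUnique_factor {τ : T.TerminalChoice} {a y z : T.FreeExtClassifier} (hz : τ.t z)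
    (h : a ⟶ y) (f : a ⟶ z) (hf : ∀ x, pull h x = .K ∨ pull f x = pull h x) :
    ∃! g : y ⟶ z, h ≫ g = f := by
  obtain ⟨g, hg⟩ := exists_factor hz h f hf
  exact ⟨g, hg, fun g' hg' => cancel_left hz h (hg'.trans hg.symm)⟩

/-- The morphism `a ⟶ r a` that keeps all colours is universal among morphisms into `t`, since any
other one only recolours `K`-edges further. -/
instance final_t : τ.t.ι.Final := by
  refine ⟨fun a => ?_⟩
  obtain ⟨η, hη⟩ := τ.exists_hom_recolour a (clr a) fun _ => Or.inr rfl
  refine isConnected_structuredArrow_of_universal (F := τ.t.ι) (c := ⟨_, τ.t_r _⟩) η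
    fun z f => ?_
  obtain ⟨g, hg, hg'⟩ := existsUnique_factor z.property η f fun x => by
    rw [hη]
    exact clr_or_pull f x
  exact ⟨ObjectProperty.homMk g, hg, fun k hk => InducedCategory.hom_ext (hg' k.hom hk)⟩

/-- Change the colour `K` into `L`. -/
def KtoL : Colour₃ → Colour₃
  | .X => .X
  | .K => .L
  | .L => .L

theorem eq_KtoL {c d : Colour₃} (h : c = .K ∨ d = c) (h' : c ≠ .X → d ≠ .X) (h'' : d ≠ .K) :
    d = KtoL c := by
  cases c <;> cases d <;> simp_all [KtoL]

/-- A `K`-edge cannot become `X`, as the degree is constant, nor stay `K`, as the target has no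
`K`-edge. -/
theorem pull_eq_KtoL {k : ℕ} {a z : T.FreeExtClassifier} (ha : degree a = k) (hz : τ.l k z)
    (f : a ⟶ z) (x : T.E a.corolla.op) : pull f x = KtoL (clr a x) :=
  eq_KtoL (clr_or_pull f x) ((degree_eq_iff f).1 (hz.1.2.trans ha.symm) x)
    ((numK_target_eq_zero f).1 hz.2 x)

theorem exists_hom_l {k : ℕ} {a : T.FreeExtClassifier} (ha : degree a = k) :
    ∃ (z : T.FreeExtClassifier) (f : a ⟶ z), τ.l k z ∧ ∀ x, pull f x = KtoL (clr a x) := by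
  obtain ⟨f, hf⟩ := τ.exists_hom_recolour a (fun x => KtoL (clr a x)) fun x => by
    cases clr a x <;> simp [KtoL]
  refine ⟨_, f, ⟨⟨τ.t_r _, ?_⟩, ?_⟩, hf⟩
  · rw [← ha, degree_eq_iff f]
    intro x
    rw [hf]
    cases clr a x <;> simp [KtoL]
  · rw [numK_target_eq_zero f]
    intro x
    rw [hf]
    cases clr a x <;> simp [KtoL]

instance final_l (k : ℕ) : (ObjectProperty.ιOfLE (τ.l_le_w k)).Final := by
  refine final_ιOfLE_of_exists_universal _ fun a ha => ?_
  obtain ⟨z, f, hz, hf⟩ := τ.exists_hom_l ha.2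
  refine ⟨z, hz, f, fun z' hz' f' => existsUnique_factor hz'.1.1 f f' fun x => Or.inr ?_⟩
  rw [hf, τ.pull_eq_KtoL ha.2 hz' f']

theorem degree_lt {a z : T.FreeExtClassifier} (f : a ⟶ z) {x : T.E a.corolla.op}
    (hx : clr a x = .K) (hx' : pull f x = .X) : degree z < degree a :=
  (degree_le f).lt_of_ne fun h => (degree_eq_iff f).1 h x (by simp [hx]) hx'

-- For an object of degree `k + 1` with a `K`-edge, the arrows into `t^(k)` are the recolourings
-- turning at least one `K` into `X`. With several `K`-edges none of them is universal, so
-- connectedness is shown by zigzags through the recolouring `m` that turns all of them into `X`.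
open Classical in
instance final_tLE (k : ℕ) : (ObjectProperty.ιOfLE (τ.tLE_le_qBar k)).Final := by
  refine ⟨fun a => ?_⟩
  obtain ⟨a, ⟨ha, hak⟩, hal⟩ := a
  let F := ObjectProperty.ιOfLE (τ.tLE_le_qBar k)
  let a' : (τ.qBar (k + 1)).FullSubcategory := ⟨a, ⟨ha, hak⟩, hal⟩
  change IsConnected (StructuredArrow a' F)
  by_cases hk : degree a ≤ k
  · let c : (τ.tLE k).FullSubcategory := ⟨a, ha, hk⟩
    refine isConnected_structuredArrow_of_universal (c := c) (𝟙 a') fun c' f => ?_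
    refine ⟨ObjectProperty.homMk f.hom, Category.id_comp _, fun g hg => ?_⟩
    have hg' : F.map g = f := (Category.id_comp _).symm.trans hg
    exact InducedCategory.hom_ext (congrArg (fun m : a' ⟶ F.obj c' => m.hom) hg')
  have hdeg : degree a = k + 1 := by omega
  have hK : ∃ x, clr a x = .K := by
    by_contra! h
    exact hal ⟨⟨ha, hdeg⟩, (numK_eq_zero a).2 h⟩
  have hex : ∀ ρ : T.E a.corolla.op → Colour₃, (∀ x, clr a x = .K ∨ ρ x = clr a x) →
      (∃ x, clr a x = .K ∧ ρ x = .X) →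
      ∃ c : StructuredArrow a' F, ∀ x, pull c.hom.hom x = ρ x := by
    rintro ρ hρ ⟨x, hx, hx'⟩
    obtain ⟨f, hf⟩ := τ.exists_hom_recolour a ρ hρ
    have h1 := degree_lt f hx ((hf x).trans hx')
    let z : (τ.tLE k).FullSubcategory := ⟨τ.r (recolour a ρ), τ.t_r _, by omega⟩
    let f' : a' ⟶ F.obj z := ObjectProperty.homMk f
    exact ⟨StructuredArrow.mk f', hf⟩
  have hfac : ∀ c c' : StructuredArrow a' F,
      (∀ x, pull c.hom.hom x = .K ∨ pull c'.hom.hom x = pull c.hom.hom x) →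
      Nonempty (c ⟶ c') := by
    intro c c' h
    obtain ⟨g, hg⟩ := exists_factor c'.right.property.1 c.hom.hom c'.hom.hom h
    exact ⟨StructuredArrow.homMk (ObjectProperty.homMk g) (InducedCategory.hom_ext hg)⟩
  obtain ⟨m, hm⟩ := hex (fun x => if clr a x = .K then .X else clr a x)
    (fun x => by by_cases h : clr a x = .K <;> simp [h])
    (hK.imp fun x hx => ⟨hx, by simp [hx]⟩)
  have hz : ∀ c, Zigzag m c := by
    intro c
    -- The degree drops along `c`, so some `K`-edge `x` becomes `X`.
    obtain ⟨x, hx, hx'⟩ : ∃ x, clr a x = .K ∧ pull c.hom.hom x = .X := by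
      by_contra! h
      have h1 := c.right.property.2
      have h2 := (degree_eq_iff c.hom.hom).2 fun x hx hx' => by
        rcases clr_or_pull c.hom.hom x with h3 | h3
        · exact h x h3 hx'
        · exact hx (h3.symm.trans hx')
      have h3 : degree c.right.obj = degree a := h2
      omega
    -- Turning only `x` into `X` gives an arrow `d` through which both `m` and `c` factor.
    obtain ⟨d, hd⟩ := hex (fun y => if y = x then .X else clr a y)
      (fun y => by by_cases h : y = x <;> simp [h, hx]) ⟨x, hx, by simp⟩
    obtain ⟨f⟩ := hfac d m fun y => by
      rw [hd, hm]
      by_cases h : y = x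
      · simp [h, hx]
      · by_cases h' : clr a y = .K <;> simp [h, h']
    obtain ⟨g⟩ := hfac d c fun y => by
      rw [hd]
      by_cases h : y = x
      · simp [h, hx']
      · simpa [h] using clr_or_pull c.hom.hom y
    exact (Zigzag.of_inv f).trans (Zigzag.of_hom g)
  have : Nonempty (StructuredArrow a' F) := ⟨m⟩
  exact zigzag_isConnected fun c c' => (hz c).symm.trans (hz c')

theorem w_le_tLE (k : ℕ) : τ.w k ≤ τ.tLE k := fun _ h => ⟨h.1, h.2.le⟩

theorem qBar_le_tLE (k : ℕ) : τ.qBar k ≤ τ.tLE k := fun _ h => h.1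

/-- Degrees do not rise, so a morphism of `t^(k)` ending in `l^(k)` has source of degree `k`; one
starting there has no `K`-edge to lose and keeps its degree. Both lie in `w^(k)`; all others avoid
`l^(k)` at both ends. -/
theorem isPushout_w_qBar {𝓔 : Type w} [Category.{v} 𝓔] [HasColimitsOfSize.{u, u} 𝓔]
    (X : T.FreeExtClassifier ⥤ 𝓔) (k : ℕ) :
    IsPushout (colimOnMap X (τ.q_le_w k)) (colimOnMap X (τ.q_le_qBar k))
      (colimOnMap X (τ.w_le_tLE k)) (colimOnMap X (τ.qBar_le_tLE k)) := by
  refine isPushout_colimOnMap X _ _ _ _ (fun a hw hq => ⟨hw, fun h => hq.2 ⟨hw, h⟩⟩) ?_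
  intro a b ha hb f
  have hab := degree_le f
  by_cases hbl : τ.l k b
  · have := hbl.1.2
    have := ha.2
    exact Or.inl ⟨⟨ha.1, by omega⟩, hbl.1⟩
  by_cases hal : τ.l k a
  · refine Or.inl ⟨hal.1, hb.1, ?_⟩
    rw [← hal.1.2, degree_eq_iff f]
    intro x hx hx'
    rcases clr_or_pull f x with h | h
    · exact (numK_eq_zero a).1 hal.2 x h
    · exact hx (h.symm.trans hx')
  · exact Or.inr ⟨⟨ha, hal⟩, hb, hbl⟩

end PolyMonad.TerminalChoice

/-! ### The objects of degree `k` form cubes. -/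

namespace PolyMonad.TerminalChoice

variable {I : Type u} {T : PolyMonad I} (τ : T.TerminalChoice) {k : ℕ}

section Cubes

variable {τ}

theorem clr_l (z : (τ.l k).FullSubcategory) (e : T.E z.obj.corolla.op) :
    clr z.obj e = .X ∨ clr z.obj e = .L := by
  have := (numK_eq_zero z.obj).1 z.property.2 e
  revert this
  cases clr z.obj e <;> simp

/-- A numbering of the `L`-edges of an object without `K`-edges. -/
noncomputable def numbering (z : (τ.l k).FullSubcategory) :
    { e : T.E z.obj.corolla.op // clr z.obj e ≠ .X } ≃ Fin k :=
  Finite.equivFinOfCardEq ((degree_eq z.obj).symm.trans z.property.1.2)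

open Classical in
/-- The colouring in which the `L`-edges outside `s` are given the colour `K`. -/
noncomputable def vertexColour (z : (τ.l k).FullSubcategory) (s : Set (Fin k))
    (e : T.E z.obj.corolla.op) : Colour₃ :=
  if h : clr z.obj e ≠ .X then if numbering z ⟨e, h⟩ ∈ s then .L else .K else .X

theorem vertexColour_eq_X {z : (τ.l k).FullSubcategory} {s : Set (Fin k)}
    {e : T.E z.obj.corolla.op} : vertexColour z s e = .X ↔ clr z.obj e = .X := by
  unfold vertexColour
  split_ifs with h h' <;> simp_all

theorem vertexColour_of_mem {z : (τ.l k).FullSubcategory} {s : Set (Fin k)} {i : Fin k}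
    (hi : i ∈ s) : vertexColour z s ((numbering z).symm i).1 = .L := by
  simp [vertexColour, hi, ((numbering z).symm i).2]

theorem vertexColour_of_notMem {z : (τ.l k).FullSubcategory} {s : Set (Fin k)} {i : Fin k}
    (hi : i ∉ s) : vertexColour z s ((numbering z).symm i).1 = .K := by
  simp [vertexColour, hi, ((numbering z).symm i).2]

theorem eq_X_or_eq_numbering (z : (τ.l k).FullSubcategory) (e : T.E z.obj.corolla.op) :
    clr z.obj e = .X ∨ ∃ i, e = ((numbering z).symm i).1 := by
  by_cases h : clr z.obj e = .X
  · exact Or.inl h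
  · exact Or.inr ⟨numbering z ⟨e, h⟩, by simp⟩

theorem KtoL_vertexColour (z : (τ.l k).FullSubcategory) (s : Set (Fin k))
    (e : T.E z.obj.corolla.op) : KtoL (vertexColour z s e) = clr z.obj e := by
  unfold vertexColour
  rcases clr_l z e with h | h
  · simp [h, KtoL]
  · split_ifs <;> simp_all [KtoL]

/-- The object `z` with the `L`-edges outside `s` recoloured by `K`. -/
noncomputable abbrev vertex (z : (τ.l k).FullSubcategory) (s : Set (Fin k)) :
    T.FreeExtClassifier :=
  recolour z.obj (vertexColour z s)

theorem degree_vertex (z : (τ.l k).FullSubcategory) (s : Set (Fin k)) :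
    degree (vertex z s) = k := by
  refine Eq.trans ?_ z.property.1.2
  rw [degree_eq, degree_eq]
  exact Nat.card_congr (Equiv.subtypeEquivRight fun e => not_congr vertexColour_eq_X)

theorem exists_hom_vertex (z : (τ.l k).FullSubcategory) {s s' : Set (Fin k)} (h : s ⊆ s') :
    ∃ f : vertex z s ⟶ τ.r (vertex z s'), ∀ x, pull f x = vertexColour z s' x := by
  refine τ.exists_hom_recolour (vertex z s) (vertexColour z s') fun e => ?_
  change vertexColour z s e = .K ∨ vertexColour z s' e = vertexColour z s e
  rcases eq_X_or_eq_numbering z e with he | ⟨i, rfl⟩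
  · rw [vertexColour_eq_X.2 he, vertexColour_eq_X.2 he]
    simp
  · by_cases hi : i ∈ s
    · rw [vertexColour_of_mem hi, vertexColour_of_mem (h hi)]
      simp
    · exact Or.inl (vertexColour_of_notMem hi)

theorem degree_r_vertex (z : (τ.l k).FullSubcategory) (s : Set (Fin k)) :
    degree (τ.r (vertex z s)) = k := by
  obtain ⟨η, hη⟩ := exists_hom_vertex z (le_refl s)
  refine ((degree_eq_iff η).2 fun x hx => ?_).trans (degree_vertex z s)
  rw [hη]
  exact hx

/-- Turning `K` into `L` restores the colours of `z` from those of any vertex, so the terminal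
vertex is recovered from the cube. -/
theorem eq_of_hom_l (z : (τ.l k).FullSubcategory) (s : Set (Fin k)) {z' : T.FreeExtClassifier}
    (hz' : τ.l k z') (f : vertex z s ⟶ z') : z' = z.obj := by
  have h : ∀ x, pull f x = clr z.obj x := fun x =>
    (τ.pull_eq_KtoL (degree_vertex z s) hz' f x).trans (KtoL_vertexColour z s x)
  rw [eq_r_of_hom hz'.1.1 f, funext h]
  exact (congrArg τ.r (colouring_clr z.obj)).trans (r_eq_self z.property.1.1)

/-- The identity substitution of `z` also underlies a morphism from the vertex, with the same effect
on colours as `f`; such a morphism into a chosen object is unique. -/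
theorem edgeMap_eq_id (z : (τ.l k).FullSubcategory) (s : Set (Fin k)) (f : vertex z s ⟶ z.obj)
    (x : T.E z.obj.corolla.op) : edgeMap f x = x := by
  have h : ∀ x, pull f x = clr z.obj x := fun x =>
    (τ.pull_eq_KtoL (degree_vertex z s) z.property f x).trans (KtoL_vertexColour z s x)
  have hid : ∀ y, (toSub (𝟙 z.obj)).edge y = y := edgeMap_id z.obj
  obtain ⟨i, hi⟩ := exists_freeExt_hom (a' := vertex z s) (a := z.obj) (toSub (𝟙 z.obj) :)
    (fun y => by
      have h1 := clr_or_pull f y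
      rw [h] at h1
      exact h1.imp_right ((congrArg _ (hid y)).trans))
    fun e he => isUnit_freeExt (𝟙 z.obj) he
  have hi' : ∀ y : T.E z.obj.corolla.op, edgeMap i y = y := fun y =>
    (congrArg (fun σ : T.Substitution _ _ => σ.edge y) hi).trans (hid y)
  rw [hom_ext_pull z.property.1.1 (f := f) (g := i) fun y => by rw [h, pull, hi'], hi']

/-- Continuing to an object of `l^(k)` reaches both `z` and `z'`. -/
theorem eq_of_hom_vertex {z z' : (τ.l k).FullSubcategory} {s s' : Set (Fin k)}
    (h : vertex z s ⟶ τ.r (vertex z' s')) : z = z' := by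
  obtain ⟨z₁, v, hz₁, -⟩ := τ.exists_hom_l (degree_r_vertex z' s')
  obtain ⟨η, -⟩ := exists_hom_vertex z' (le_refl s')
  obtain ⟨z, hz⟩ := z
  obtain ⟨z', hz'⟩ := z'
  obtain rfl : z = z' := (eq_of_hom_l _ s hz₁ (h ≫ v)).symm.trans (eq_of_hom_l _ s' hz₁ (η ≫ v))
  rfl

/-- Rules out permutations of edges: followed by `v`, both `h` and the canonical `η` are the
identity on edges, and `v` has a single preimage over each non-`X` edge. -/
theorem pull_hom_vertex {z : (τ.l k).FullSubcategory} {s s' : Set (Fin k)}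
    (h : vertex z s ⟶ τ.r (vertex z s')) (x : T.E z.obj.corolla.op) :
    pull h x = vertexColour z s' x := by
  by_cases hx : clr z.obj x = .X
  · rw [vertexColour_eq_X.2 hx]
    exact pull_eq_X h (vertexColour_eq_X.2 hx)
  obtain ⟨z₁, v, hz₁, -⟩ := τ.exists_hom_l (degree_r_vertex z s')
  obtain ⟨η, hη⟩ := exists_hom_vertex z (le_refl s')
  obtain rfl := eq_of_hom_l _ s hz₁ (h ≫ v)
  have h1 := edgeMap_eq_id z s (h ≫ v) x
  have h2 := edgeMap_eq_id z s' (η ≫ v) x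
  rw [edgeMap_comp] at h1 h2
  rw [← hη, pull, pull]
  exact congrArg _ ((existsUnique_freeExt v hx).unique h1 h2)

instance subsingleton_hom_vertex (z : (τ.l k).FullSubcategory) (s s' : Set (Fin k)) :
    Subsingleton (τ.r (vertex z s) ⟶ τ.r (vertex z s')) := by
  refine ⟨fun g g' => ?_⟩
  obtain ⟨η, -⟩ := exists_hom_vertex z (le_refl s)
  refine cancel_left (τ.t_r _) η (hom_ext_pull (τ.t_r _) fun x => ?_)
  rw [pull_hom_vertex, pull_hom_vertex]

theorem nonempty_hom_vertex (z : (τ.l k).FullSubcategory) {s s' : Set (Fin k)} (h : s ⊆ s') :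
    Nonempty (τ.r (vertex z s) ⟶ τ.r (vertex z s')) := by
  obtain ⟨η, hη⟩ := exists_hom_vertex z (le_refl s)
  obtain ⟨f, hf⟩ := exists_hom_vertex z h
  obtain ⟨g, -⟩ := exists_factor (τ.t_r _) η f fun x => by
    rw [hη]
    exact clr_or_pull f x
  exact ⟨g⟩

theorem subset_of_hom_vertex {z : (τ.l k).FullSubcategory} {s s' : Set (Fin k)}
    (h : vertex z s ⟶ τ.r (vertex z s')) : s ⊆ s' := by
  intro i hi
  by_contra hi'
  have h1 := clr_or_pull h ((numbering z).symm i).1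
  have h2 : clr (vertex z s) ((numbering z).symm i).1 = .L := vertexColour_of_mem hi
  rw [pull_hom_vertex, vertexColour_of_notMem hi', h2] at h1
  simp at h1

/-- The cube of an object of degree `k` without `K`-edges. -/
noncomputable def cube (z : (τ.l k).FullSubcategory) :
    Set (Fin k) ⥤ (τ.w k).FullSubcategory where
  obj s := ⟨τ.r (vertex z s), τ.t_r _, degree_r_vertex z s⟩
  map f := ObjectProperty.homMk (nonempty_hom_vertex z (leOfHom f)).some
  map_id _ := InducedCategory.hom_ext (Subsingleton.elim (h := subsingleton_hom_vertex z _ _) _ _)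
  map_comp _ _ :=
    InducedCategory.hom_ext (Subsingleton.elim (h := subsingleton_hom_vertex z _ _) _ _)

variable (τ k) in
/-- The coproduct of the cubes of all objects of degree `k` without `K`-edges. -/
noncomputable def cubes :
    (Σ _ : (τ.l k).FullSubcategory, Set (Fin k)) ⥤ (τ.w k).FullSubcategory :=
  Sigma.desc cube

theorem hom_of_hom_cubes {p p' : Σ _ : (τ.l k).FullSubcategory, Set (Fin k)}
    (f : (τ.cubes k).obj p ⟶ (τ.cubes k).obj p') :
    Nonempty (vertex p.1 p.2 ⟶ τ.r (vertex p'.1 p'.2)) := by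
  obtain ⟨η, -⟩ := exists_hom_vertex p.1 (le_refl p.2)
  exact ⟨η ≫ f.hom⟩

instance full_cubes : (τ.cubes k).Full where
  map_surjective {p p'} f := by
    obtain ⟨h⟩ := hom_of_hom_cubes f
    obtain ⟨z, s⟩ := p
    obtain ⟨z', s'⟩ := p'
    obtain rfl : z = z' := eq_of_hom_vertex h
    exact ⟨Sigma.SigmaHom.mk (homOfLE (subset_of_hom_vertex h)), InducedCategory.hom_ext
      (Subsingleton.elim (h := subsingleton_hom_vertex z _ _) _ _)⟩

instance faithful_cubes : (τ.cubes k).Faithful where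
  map_injective {p p'} f g _ := by
    have key : ∀ f g : Sigma.SigmaHom p p', f = g := by
      rintro ⟨f⟩ ⟨g⟩
      exact congrArg _ (Subsingleton.elim _ _)
    exact key f g

theorem injective_cubes : Function.Injective (τ.cubes k).obj := by
  rintro ⟨z, s⟩ ⟨z', s'⟩ h
  obtain ⟨f⟩ := hom_of_hom_cubes (eqToHom h)
  obtain ⟨g⟩ := hom_of_hom_cubes (eqToHom h.symm)
  obtain rfl : z = z' := eq_of_hom_vertex f
  obtain rfl : s = s' := (subset_of_hom_vertex f).antisymm (subset_of_hom_vertex g)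
  rfl

theorem surjective_cubes : Function.Surjective (τ.cubes k).obj := by
  rintro ⟨a, ha⟩
  obtain ⟨z, f, hz, hf⟩ := τ.exists_hom_l ha.2
  let z' : (τ.l k).FullSubcategory := ⟨z, hz⟩
  -- The `L`-edges of `z` that were already `L` in `a`; the quantifier over `x` runs over a
  -- one-element fibre.
  let s : Set (Fin k) := {i | ∀ x, edgeMap f x = ((numbering z').symm i).1 → clr a x = .L}
  have hX : ∀ x, clr z (edgeMap f x) = .X ↔ clr a x = .X := fun x => by
    refine Iff.trans (Eq.congr_left (hf x)) ?_
    cases clr a x <;> simp [KtoL]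
  have hs : ∀ x, vertexColour z' s (edgeMap f x) = clr a x := fun x => by
    rcases eq_X_or_eq_numbering z' (edgeMap f x) with h | ⟨i, hi⟩
    · rw [vertexColour_eq_X.2 h, (hX x).1 h]
    · have hx : clr z (edgeMap f x) ≠ .X := by rw [hi]; exact ((numbering z').symm i).2
      have hmem : i ∈ s ↔ clr a x = .L := ⟨fun h => h x hi, fun h y hy => by
        rwa [(existsUnique_freeExt f hx).unique (hy.trans hi.symm) rfl]⟩
      rw [hi]
      by_cases h : i ∈ s
      · rw [vertexColour_of_mem h, hmem.1 h]
      · rw [vertexColour_of_notMem h]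
        have h1 := mt hmem.2 h
        have h2 := mt (hX x).2 hx
        revert h1 h2
        cases clr a x <;> simp
  -- With the colours of the vertex on its target, `f` preserves colours, so `a` is the chosen
  -- object in the component of that vertex.
  obtain ⟨g, -⟩ := exists_plus_hom (a' := toPlusTwo a) (a := toPlusTwo (vertex z' s))
    (toSub f :) hs fun e he => isUnit_freeExt f fun h => he (vertexColour_eq_X.2 h)
  refine ⟨⟨z', s⟩, ObjectProperty.FullSubcategory.ext ?_⟩
  exact (r_eq_of_hom g).symm.trans (r_eq_self ha.1)

theorem numK_cubes (z : (τ.l k).FullSubcategory) (s : Set (Fin k)) :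
    numK ((τ.cubes k).obj ⟨z, s⟩).obj = 0 ↔ s = Set.univ := by
  obtain ⟨η, hη⟩ := exists_hom_vertex z (le_refl s)
  refine (numK_target_eq_zero η).trans ?_
  rw [Set.eq_univ_iff_forall]
  constructor
  · intro h i
    by_contra hi
    exact h _ ((hη _).trans (vertexColour_of_notMem hi))
  · intro h x
    rw [hη]
    rcases eq_X_or_eq_numbering z x with hx | ⟨i, rfl⟩
    · rw [vertexColour_eq_X.2 hx]
      simp
    · rw [vertexColour_of_mem (h i)]
      simp

end Cubes

end PolyMonad.TerminalChoice

/-! ### The theorem. -/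

theorem theorem7p7 {I : Type u} (T : PolyMonad I) (hT : T.Tame)
    {𝓔 : Type w} [Category.{v} 𝓔] [HasColimitsOfSize.{u, u} 𝓔] (X : T.FreeExtClassifier ⥤ 𝓔) :
    Nonempty T.TerminalChoice ∧ ∀ τ : T.TerminalChoice,
      -- `colim X` is the sequential colimit of the `P_k`
      Nonempty (IsColimit (colimOnCocone X τ.tLE τ.tLE_mono)) ∧
      -- the sequence starts with `P_0 = L_0`
      IsIso (colimOnMap X (τ.l_le_tLE 0)) ∧
      -- `P_k ⟶ P_{k+1}` is a pushout of `Q_{k+1} ⟶ L_{k+1}`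
      (∀ k : ℕ,
        IsIso (colimOnMap X (τ.l_le_w (k + 1))) ∧
        IsIso (colimOnMap X (τ.tLE_le_qBar k)) ∧
        ∃ (w : colimOn X (τ.q (k + 1)) ⟶ colimOn X (τ.l (k + 1)))
          (α : colimOn X (τ.q (k + 1)) ⟶ colimOn X (τ.tLE k)),
          w ≫ colimOnMap X (τ.l_le_w (k + 1)) = colimOnMap X (τ.q_le_w (k + 1)) ∧
          α ≫ colimOnMap X (τ.tLE_le_qBar k) = colimOnMap X (τ.q_le_qBar (k + 1)) ∧
          IsPushout w α (colimOnMap X (τ.l_le_tLE (k + 1)))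
            (colimOnMap X (τ.tLE_mono k.le_succ))) ∧
      -- the objects of degree `k` form a coproduct of `k`-cubes, those with a `K`-edge
      -- (resp. without) being the punctured cubes (resp. the terminal vertices)
      (∀ k : ℕ, ∃ (A : Type u) (F : (Σ _ : A, Set (Fin k)) ⥤ (τ.w k).FullSubcategory),
        F.IsEquivalence ∧ Function.Bijective F.obj ∧
        ∀ (a : A) (s : Set (Fin k)),
          (τ.q k (F.obj ⟨a, s⟩).obj ↔ s ≠ Set.univ) ∧
          (τ.l k (F.obj ⟨a, s⟩).obj ↔ s = Set.univ)) := by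
  refine ⟨PolyMonad.nonempty_terminalChoice hT, fun τ => ⟨?_, ?_, fun k => ?_, fun k => ?_⟩⟩
  · exact isColimit_colimOnCocone X (U := τ.t) τ.tLE τ.tLE_mono (fun _ _ h => h.1)
      -- The stage containing `a` is its own degree.
      fun a ha => ⟨_, ha, le_rfl⟩
  · refine isIso_colimOnMap_of_le X _ fun a ha => ?_
    have h0 : PolyMonad.numK a + PolyMonad.numL a ≤ 0 := ha.2
    exact ⟨⟨ha.1, Nat.le_zero.1 ha.2⟩, by omega⟩
  · have h1 := isIso_colimOnMap X (τ.l_le_w (k + 1))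
    have h2 := isIso_colimOnMap X (τ.tLE_le_qBar k)
    refine ⟨h1, h2, colimOnMap X (τ.q_le_w (k + 1)) ≫ inv (colimOnMap X (τ.l_le_w (k + 1))),
      colimOnMap X (τ.q_le_qBar (k + 1)) ≫ inv (colimOnMap X (τ.tLE_le_qBar k)),
      by simp, by simp, ?_⟩
    -- The pushout over `w` and `qBar` is transported along the two isomorphisms given by finality.
    refine (τ.isPushout_w_qBar X (k + 1)).of_iso (Iso.refl _)
      (asIso (colimOnMap X (τ.l_le_w (k + 1)))).symm
      (asIso (colimOnMap X (τ.tLE_le_qBar k))).symm (Iso.refl _) ?_ ?_ ?_ ?_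
    · simp
    · simp
    · rw [Iso.symm_hom, asIso_inv, IsIso.eq_inv_comp, Iso.refl_hom, Category.comp_id,
        colimOnMap_comp]
    · rw [Iso.symm_hom, asIso_inv, IsIso.eq_inv_comp, Iso.refl_hom, Category.comp_id,
        colimOnMap_comp]
  · have : (τ.cubes k).EssSurj := ⟨fun a => by
      obtain ⟨p, rfl⟩ := PolyMonad.TerminalChoice.surjective_cubes a
      exact ⟨p, ⟨Iso.refl _⟩⟩⟩
    refine ⟨_, τ.cubes k, { }, ⟨PolyMonad.TerminalChoice.injective_cubes,
      PolyMonad.TerminalChoice.surjective_cubes⟩, fun z s => ?_⟩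
    have hw := ((τ.cubes k).obj ⟨z, s⟩).property
    rw [ne_eq, ← PolyMonad.TerminalChoice.numK_cubes z s]
    exact ⟨⟨fun h => h.2, fun h => ⟨hw, h⟩⟩, ⟨fun h => h.2, fun h => ⟨hw, h⟩⟩⟩
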